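/- Let $0<\epsilon<M$, $T>0$ and $0<\underline c<\overline c$, and let $c\in C^3(\mathbb R)$ satisfy $c(x)\in[\underline c,\overline c]$ for $x\in[\epsilon,M]$ and $c(x)=1$ for $x\notin[\epsilon,M]$. Put $\tau(x)=\int_0^x\sqrt{c(s)}\,ds$. Let $u$ be a locally integrable weak solution on $\mathbb R\times[0,\infty)$ of $$c(x)u_{tt}=u_{xx},\qquad u(x,0)=0,\qquad u_t(x,0)=\delta_0(x),$$ that is, $\int_0^\infty\!\int_{\mathbb R}u\,(c\,\varphi_{tt}-\varphi_{xx})\,dx\,dt=c(0)\varphi(0,0)$ for all $\varphi\in C_c^\infty(\mathbb R^2)$. Then, after modification on a null set, $u$ is continuous on $\{t\ge|\tau(x)|\}$ (its value on the front $t=|\tau(x)|$ being the limit from behind the front) and zero for $t<|\tau(x)|$. For this version of $u$ let $$q(x,t)=u(x,t+\tau(x)),\qquad g_0(t)=u(\epsilon,t),\qquad g_1(t)=u_x(\epsilon,t).$$ Then $q$ is of class $C^2$ on $(0,\infty)\times[0,\infty)$, and 1. $\displaystyle q_{xx}(x,t)-\frac{q_{xt}(x,t)}{2q^2(x,0)}+\frac{q_t(x,t)\,q_x(x,0)}{2q^3(x,0)}=0$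 for $(x,t)\in(\epsilon,M)\times(0,T)$; 2. $\displaystyle q(x,0)\ge\frac1{2\overline c^{1/4}}>0$ for $x\in[\epsilon,M]$; 3. $q(\epsilon,t)=g_0(t+\epsilon)$ for $t\in[0,T]$; 4. $q_x(\epsilon,t)=g_1(t+\epsilon)+g_0'(t+\epsilon)$ for $t\in[0,T]$, where for $t>0$ the derivatives $u_x(\epsilon,t+\epsilon)$ and $g_0'(t+\epsilon)$ exist, and for $t=0$ the values $g_1(\epsilon)$ and $g_0'(\epsilon)$ are understood as limits from the right, which exist; 5. $q_x(M,t)=0$ for $t\in[0,T]$; 6. $\displaystyle c(x)=\frac1{16\,q^4(x,0)}$ for $x\in[\epsilon,M]$. -/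

import Mathlib

open Set Filter Topology MeasureTheory
open scoped ContDiff

/-- The travel time `τ(x) = ∫₀ˣ √c(s) ds` from the source at `0` to `x` (signed). -/
noncomputable def travelTime (c : ℝ → ℝ) (x : ℝ) : ℝ :=
  ∫ s in (0 : ℝ)..x, Real.sqrt (c s)

/-- `u` is a locally integrable weak (distributional) solution on `ℝ × [0, ∞)` of
`c(x) u_tt = u_xx`, `u(x, 0) = 0`, `u_t(x, 0) = δ₀(x)`.
The test functions need not vanish at `t = 0`, so that integrating by parts twice in `t`
encodes both initial conditions: the boundary term is `∫ c(x) δ₀(x) φ(x, 0) dx = c(0) φ(0, 0)`. -/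
structure IsWeakWaveSolution (c : ℝ → ℝ) (u : ℝ → ℝ → ℝ) : Prop where
  locallyIntegrable :
    LocallyIntegrableOn (fun p : ℝ × ℝ => u p.1 p.2) (univ ×ˢ Ici 0) volume
  weak_eq : ∀ φ : ℝ × ℝ → ℝ, ContDiff ℝ ∞ φ → HasCompactSupport φ →
    ∫ p in (univ : Set ℝ) ×ˢ Ioi (0 : ℝ),
        u p.1 p.2 * (c p.1 * iteratedDeriv 2 (fun t => φ (p.1, t)) p.2
          - iteratedDeriv 2 (fun x => φ (x, p.2)) p.1)
      = c 0 * φ (0, 0)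

/-- `U` is the pointwise version of the (almost everywhere defined) function `u`: it is continuous
behind the wave front and up to it, that is on `{t ≥ |τ(x)|}`, and it is zero ahead of the front.
In particular its value on the front is the limit from behind,
`U(x, |τ(x)|) = lim_{t → |τ(x)|⁺} U(x, t)`.
These conditions determine `U` uniquely. -/
structure IsPointwiseVersion (c : ℝ → ℝ) (u U : ℝ → ℝ → ℝ) : Prop where
  ae_eq : (fun p : ℝ × ℝ => U p.1 p.2)
    =ᵐ[volume.restrict ((univ : Set ℝ) ×ˢ Ioi (0 : ℝ))] fun p => u p.1 p.2
  continuousOn : ContinuousOn (fun p : ℝ × ℝ => U p.1 p.2) {p | |travelTime c p.1| ≤ p.2}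
  eq_zero : ∀ x t, t < |travelTime c x| → U x t = 0

/-! Write `b = c^(-1/4)`, `s = t + τ(x)`, `r = t - τ(x)`. The Liouville substitution `φ = b(x) Ω(s,
r)` removes the first-order terms: `c φ_tt - φ_xx = (4/b³) Ω_sr - b'' Ω`. The wave equation thus
becomes `Ω_sr = k Ω` with `k = b³ b''/4`, and the cone `t ≥ |τ(x)|` becomes the quadrant `s, r ≥ 0`.
Since `c = 1` at the source, the front carries d'Alembert's value `1/2`. This singles out the
solution `V` of the Goursat problem `V_sr = k V`, `V = 1/2` on both axes
(`exists_isRiemannFunction`), and the candidate `b V` inside the cone, zero outside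
(`coneSolution`).

That every weak solution equals this candidate almost everywhere is shown by duality
(`integral_weak_solution`). For a test function `ψ`, the backward Goursat problem with source
`b³ψ/4` has a solution `W` vanishing for large `s` or large `r`. Testing the weak equation with `b
W` gives `∫ u ψ = W(0,0)`, and Green's identity for `V` and `W` (`green_rectangle`) gives the same
value for the candidate. As `b W` is only `C²` and not compactly supported in the past, the weak
equation is extended to `C²` test functions by mollification, and `b W` is cut off at negative
times. The Goursat problems are solved by a contraction in a weighted sup norm (`exists_volterra`).

For `x, t ≥ 0` this gives `q(x,t) = b(x) V(t + 2τ(x), t)`, which extends to a `C²` function on the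
plane: `c ∈ C³` makes `k` of class `C¹` and hence `V` of class `C²`. On `t = 0`, `q = b/2` and `q_x
= b'/2`, because `V` is constant on the axis; this yields the lower bound and the recovery of `c`,
and turns the equation for `q` into `V_sr = k V`. At `M` the derivative vanishes because `b'(M) = 0`
and no wave is reflected from the region `x ≥ M`, where `k = 0`. -/

/-! ### Regularity of functions of two variables and of iterated primitives. -/

/-- A function of two real variables with continuous partial derivatives is differentiable. -/
theorem hasFDerivAt_of_partials {f f₁ f₂ : ℝ × ℝ → ℝ}
    (h₁ : ∀ x y, HasDerivAt (fun s => f (s, y)) (f₁ (x, y)) x)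
    (h₂ : ∀ x y, HasDerivAt (fun s => f (x, s)) (f₂ (x, y)) y)
    (c₁ : Continuous f₁) (c₂ : Continuous f₂) (p : ℝ × ℝ) :
    HasFDerivAt f (f₁ p • ContinuousLinearMap.fst ℝ ℝ ℝ
      + f₂ p • ContinuousLinearMap.snd ℝ ℝ ℝ) p := by
  have := (hasStrictFDerivAt_uncurry_coprod (𝕜 := ℝ) (u := p) (f := fun x y => f (x, y))
    (f₁ := fun x y => ContinuousLinearMap.toSpanSingleton ℝ (f₁ (x, y)))
    (f₂ := fun x y => ContinuousLinearMap.toSpanSingleton ℝ (f₂ (x, y)))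
    (Eventually.of_forall fun v => (h₁ v.1 v.2).hasFDerivAt)
    (Eventually.of_forall fun v => (h₂ v.1 v.2).hasFDerivAt)
    ((ContinuousLinearMap.toSpanSingletonCLE (𝕜 := ℝ) (E := ℝ)).continuous.comp c₁).continuousAt
    ((ContinuousLinearMap.toSpanSingletonCLE (𝕜 := ℝ) (E := ℝ)).continuous.comp c₂).continuousAt
    ).hasFDerivAt
  convert! this using 1
  ext <;> simp [Function.HasUncurry.uncurry]

/-- A function of two real variables whose partial derivatives are `C^n` is `C^(n+1)`. -/
theorem contDiff_succ_of_partials {n : ℕ} {f f₁ f₂ : ℝ × ℝ → ℝ}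
    (h₁ : ∀ x y, HasDerivAt (fun s => f (s, y)) (f₁ (x, y)) x)
    (h₂ : ∀ x y, HasDerivAt (fun s => f (x, s)) (f₂ (x, y)) y)
    (c₁ : ContDiff ℝ n f₁) (c₂ : ContDiff ℝ n f₂) : ContDiff ℝ (n + 1) f := by
  have h := hasFDerivAt_of_partials h₁ h₂ c₁.continuous c₂.continuous
  rw [contDiff_succ_iff_fderiv]
  refine ⟨fun p => (h p).differentiableAt, by simp, ?_⟩
  have : fderiv ℝ f = fun p => f₁ p • ContinuousLinearMap.fst ℝ ℝ ℝ
      + f₂ p • ContinuousLinearMap.snd ℝ ℝ ℝ := funext fun p => (h p).fderiv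
  rw [this]
  fun_prop

/-- Differentiation under the integral sign; the dominating constant is the maximum of the
continuous `f'` on a compact neighbourhood of `{x} × [a, b]`. -/
theorem hasDerivAt_parametric_intervalIntegral {f f' : ℝ × ℝ → ℝ} (hf : Continuous f)
    (hf' : Continuous f') (h : ∀ x t, HasDerivAt (fun s => f (s, t)) (f' (x, t)) x)
    (a b x : ℝ) :
    HasDerivAt (fun x => ∫ t in a..b, f (x, t)) (∫ t in a..b, f' (x, t)) x := by
  obtain ⟨C, hC⟩ := ((isCompact_closedBall x 1).prod (isCompact_uIcc (a := a) (b := b))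
    ).exists_bound_of_continuousOn hf'.continuousOn
  refine (intervalIntegral.hasDerivAt_integral_of_dominated_loc_of_deriv_le
    (F := fun x t => f (x, t)) (F' := fun x t => f' (x, t)) (bound := fun _ => C)
    (Metric.closedBall_mem_nhds x one_pos) ?_ ?_ ?_ ?_ ?_ ?_).2
  · exact Eventually.of_forall fun y =>
      (hf.comp (by fun_prop : Continuous fun t => (y, t))).aestronglyMeasurable
  · exact (hf.comp (by fun_prop : Continuous fun t => (x, t))).intervalIntegrable _ _
  · exact (hf'.comp (by fun_prop : Continuous fun t => (x, t))).aestronglyMeasurable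
  · exact Eventually.of_forall fun t ht y hy => hC (y, t) ⟨hy, uIoc_subset_uIcc ht⟩
  · exact intervalIntegrable_const
  · exact Eventually.of_forall fun t _ y _ => h y t

/-- The primitive in the second variable. -/
noncomputable def primSnd (G : ℝ × ℝ → ℝ) (p : ℝ × ℝ) : ℝ := ∫ r in (0 : ℝ)..p.2, G (p.1, r)

/-- The primitive in the first variable. -/
noncomputable def primFst (G : ℝ × ℝ → ℝ) (p : ℝ × ℝ) : ℝ := ∫ s in (0 : ℝ)..p.1, G (s, p.2)

theorem continuous_primSnd {G : ℝ × ℝ → ℝ} (hG : Continuous G) : Continuous (primSnd G) :=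
  intervalIntegral.continuous_parametric_primitive_of_continuous (f := fun x t => G (x, t)) hG

theorem continuous_primFst {G : ℝ × ℝ → ℝ} (hG : Continuous G) : Continuous (primFst G) :=
  (continuous_primSnd (hG.comp continuous_swap)).comp continuous_swap

theorem hasDerivAt_primSnd {G : ℝ × ℝ → ℝ} (hG : Continuous G) (x y : ℝ) :
    HasDerivAt (fun t => primSnd G (x, t)) (G (x, y)) y :=
  intervalIntegral.integral_hasDerivAt_right
    ((hG.comp (by fun_prop : Continuous fun t => (x, t))).intervalIntegrable _ _)
    ((hG.comp (by fun_prop : Continuous fun t => (x, t))).stronglyMeasurableAtFilter _ _)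
    (hG.comp (by fun_prop : Continuous fun t => (x, t))).continuousAt

theorem hasDerivAt_primFst {G : ℝ × ℝ → ℝ} (hG : Continuous G) (x y : ℝ) :
    HasDerivAt (fun t => primFst G (t, y)) (G (x, y)) x :=
  hasDerivAt_primSnd (hG.comp continuous_swap) y x

theorem hasDerivAt_fst_of_contDiff {G : ℝ × ℝ → ℝ} (hG : ContDiff ℝ 1 G) (x y : ℝ) :
    HasDerivAt (fun s => G (s, y)) (fderiv ℝ G (x, y) (1, 0)) x :=
  ((hG.differentiable one_ne_zero (x, y)).hasFDerivAt.comp_hasDerivAt x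
    ((hasDerivAt_id x).prodMk (hasDerivAt_const x y)))

theorem hasDerivAt_snd_of_contDiff {G : ℝ × ℝ → ℝ} (hG : ContDiff ℝ 1 G) (x y : ℝ) :
    HasDerivAt (fun s => G (x, s)) (fderiv ℝ G (x, y) (0, 1)) y :=
  ((hG.differentiable one_ne_zero (x, y)).hasFDerivAt.comp_hasDerivAt y
    ((hasDerivAt_const y x).prodMk (hasDerivAt_id y)))

theorem contDiff_primSnd {G : ℝ × ℝ → ℝ} (hG : ContDiff ℝ 1 G) : ContDiff ℝ 1 (primSnd G) := by
  have c : Continuous fun p => fderiv ℝ G p (1, 0) :=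
    (hG.continuous_fderiv one_ne_zero).clm_apply continuous_const
  have := contDiff_succ_of_partials (n := 0) (f := primSnd G)
    (f₁ := primSnd fun p => fderiv ℝ G p (1, 0))
    (fun x y => hasDerivAt_parametric_intervalIntegral hG.continuous c
      (hasDerivAt_fst_of_contDiff hG) 0 y x)
    (hasDerivAt_primSnd hG.continuous) (contDiff_zero.2 (continuous_primSnd c))
    (contDiff_zero.2 hG.continuous)
  simpa using this

theorem contDiff_primFst {G : ℝ × ℝ → ℝ} (hG : ContDiff ℝ 1 G) : ContDiff ℝ 1 (primFst G) :=
  (contDiff_primSnd (hG.comp (contDiff_snd.prodMk contDiff_fst))).comp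
    (contDiff_snd.prodMk contDiff_fst)

theorem hasDerivAt_primFst_primSnd {G : ℝ × ℝ → ℝ} (hG : Continuous G) (x y : ℝ) :
    HasDerivAt (fun t => primFst (primSnd G) (x, t)) (primFst G (x, y)) y :=
  hasDerivAt_parametric_intervalIntegral (f := fun p => primSnd G (p.2, p.1))
    (f' := fun p => G (p.2, p.1))
    ((continuous_primSnd hG).comp continuous_swap) (hG.comp continuous_swap)
    (fun r s => hasDerivAt_primSnd hG s r) 0 x y

theorem contDiff_one_primFst_primSnd {G : ℝ × ℝ → ℝ} (hG : Continuous G) :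
    ContDiff ℝ 1 (primFst (primSnd G)) := by
  simpa using contDiff_succ_of_partials (n := 0) (f := primFst (primSnd G))
    (hasDerivAt_primFst (continuous_primSnd hG)) (hasDerivAt_primFst_primSnd hG)
    (contDiff_zero.2 (continuous_primSnd hG)) (contDiff_zero.2 (continuous_primFst hG))

/-- The two partial derivatives are `primSnd G` and `primFst G`. Each integrates in one variable
only, so `G` must already be `C¹` for both to be `C¹`. -/
theorem contDiff_two_primFst_primSnd {G : ℝ × ℝ → ℝ} (hG : ContDiff ℝ 1 G) :
    ContDiff ℝ 2 (primFst (primSnd G)) := by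
  have := contDiff_succ_of_partials (n := 1) (f := primFst (primSnd G))
    (hasDerivAt_primFst (continuous_primSnd hG.continuous))
    (hasDerivAt_primFst_primSnd hG.continuous)
    (contDiff_primSnd hG) (contDiff_primFst hG)
  norm_num at this
  exact this

/-! ### Weighted estimates and the Volterra equation. -/

/-- The majorant has primitive `(C / l) sinh (l s)`, and `|sinh| ≤ cosh`. The even weight `cosh`
handles both signs of `x`; the gained factor `1 / l` is the source of the contraction. -/
theorem abs_intervalIntegral_le_cosh {g : ℝ → ℝ} {l C : ℝ} (hl : 1 ≤ l) (hC : 0 ≤ C)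
    (h : ∀ s, |g s| ≤ C * Real.cosh (l * s)) (x : ℝ) :
    |∫ s in (0 : ℝ)..x, g s| ≤ C / l * Real.cosh (l * x) := by
  have hl0 : l ≠ 0 := by positivity
  have hd : ∀ s : ℝ, HasDerivAt (fun s => C / l * Real.sinh (l * s)) (C * Real.cosh (l * s)) s := by
    intro s
    have := ((Real.hasDerivAt_sinh (l * s)).comp s
      ((hasDerivAt_id s).const_mul l)).const_mul (C / l)
    refine this.congr_deriv ?_
    field_simp
  have hi : IntervalIntegrable (fun s => C * Real.cosh (l * s)) volume 0 x :=
    (by fun_prop : Continuous fun s => C * Real.cosh (l * s)).intervalIntegrable _ _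
  have h1 := intervalIntegral.norm_integral_le_abs_of_norm_le (f := g) (μ := volume)
    (a := 0) (b := x) (Eventually.of_forall fun s => h s) hi
  rw [intervalIntegral.integral_eq_sub_of_hasDerivAt (fun s _ => hd s) hi] at h1
  simp only [mul_zero, Real.sinh_zero, sub_zero, Real.norm_eq_abs] at h1
  refine h1.trans ?_
  rw [abs_mul, abs_of_nonneg (by positivity)]
  gcongr
  rw [abs_le]
  have := Real.sinh_lt_cosh (l * x)
  have := Real.sinh_lt_cosh (-(l * x))
  rw [Real.sinh_neg, Real.cosh_neg] at this
  constructor <;> linarith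

theorem abs_primFst_primSnd_le {G : ℝ × ℝ → ℝ} {l C : ℝ} (hl : 1 ≤ l) (hC : 0 ≤ C)
    (h : ∀ p : ℝ × ℝ, |G p| ≤ C * (Real.cosh (l * p.1) * Real.cosh (l * p.2))) (p : ℝ × ℝ) :
    |primFst (primSnd G) p| ≤ C / l ^ 2 * (Real.cosh (l * p.1) * Real.cosh (l * p.2)) := by
  have h1 : ∀ s r : ℝ, |primSnd G (s, r)| ≤ C / l * Real.cosh (l * r) * Real.cosh (l * s) := by
    intro s r
    have := abs_intervalIntegral_le_cosh hl (mul_nonneg hC (Real.cosh_pos (l * s)).le)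
      (g := fun r => G (s, r)) (fun r => (h (s, r)).trans_eq (by ring)) r
    exact this.trans_eq (by ring)
  have := abs_intervalIntegral_le_cosh hl (C := C / l * Real.cosh (l * p.2))
    (by have := Real.cosh_pos (l * p.2); positivity) (fun s => h1 s p.2) p.1
  refine this.trans_eq ?_
  have : l ≠ 0 := by positivity
  field_simp

theorem primFst_primSnd_sub {G H : ℝ × ℝ → ℝ} (hG : Continuous G) (hH : Continuous H)
    (p : ℝ × ℝ) : primFst (primSnd G) p - primFst (primSnd H) p
      = primFst (primSnd fun p => G p - H p) p := by
  have h1 : (primSnd fun p => G p - H p) = fun p => primSnd G p - primSnd H p := by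
    funext p
    exact intervalIntegral.integral_sub
      ((hG.comp (by fun_prop : Continuous fun t => (p.1, t))).intervalIntegrable _ _)
      ((hH.comp (by fun_prop : Continuous fun t => (p.1, t))).intervalIntegrable _ _)
  rw [h1]
  exact (intervalIntegral.integral_sub
    (((continuous_primSnd hG).comp (by fun_prop : Continuous fun t => (t, p.2))
      ).intervalIntegrable _ _)
    (((continuous_primSnd hH).comp (by fun_prop : Continuous fun t => (t, p.2))
      ).intervalIntegrable _ _)).symm

theorem primFst_primSnd_eq_zero {G : ℝ × ℝ → ℝ}
    (h : ∀ p : ℝ × ℝ, 0 ≤ p.1 ∨ 0 ≤ p.2 → G p = 0) (p : ℝ × ℝ) (hp : 0 ≤ p.1 ∨ 0 ≤ p.2) :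
    primFst (primSnd G) p = 0 := by
  have key : ∀ s r : ℝ, 0 ≤ s ∨ 0 ≤ r → primSnd G (s, r) = 0 := by
    intro s r hsr
    refine intervalIntegral.integral_zero_ae (Eventually.of_forall fun t ht => ?_)
    rcases hsr with hs | hr
    · exact h _ (Or.inl hs)
    · rw [uIoc_of_le hr] at ht
      exact h _ (Or.inr ht.1.le)
  refine intervalIntegral.integral_zero_ae (Eventually.of_forall fun t ht => ?_)
  rcases hp with hs | hr
  · rw [uIoc_of_le hs] at ht
    exact key _ _ (Or.inl ht.1.le)
  · exact key _ _ (Or.inr hr)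

/-- The continuous solution of the linear Goursat problem `∂₁∂₂ W = F + k W` with `W = 0` on both
coordinate axes, as a solution of the equivalent Volterra equation. -/
theorem exists_volterra {k F : ℝ × ℝ → ℝ} (hk : Continuous k) (hF : Continuous F) {K C : ℝ}
    (hkb : ∀ p, |k p| ≤ K) (hFb : ∀ p, |F p| ≤ C) :
    ∃ W : ℝ × ℝ → ℝ, Continuous W ∧ (∀ p, W p = primFst (primSnd fun p => F p + k p * W p) p) ∧
      ((∀ p : ℝ × ℝ, 0 ≤ p.1 ∨ 0 ≤ p.2 → F p = 0) →
        ∀ p : ℝ × ℝ, 0 ≤ p.1 ∨ 0 ≤ p.2 → W p = 0) := by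
  have hK : 0 ≤ K := (abs_nonneg _).trans (hkb 0)
  have hC : 0 ≤ C := (abs_nonneg _).trans (hFb 0)
  -- The double primitive gains `1 / l²` in the norm weighted by `w`, so the contraction constant is
  -- `K / (K + 1)² ≤ 1 / 2`. The fixed point is sought as `W = w Z` with `Z` bounded.
  set l : ℝ := K + 1 with hl_def
  have hl : 1 ≤ l := by linarith
  set w : ℝ × ℝ → ℝ := fun p => Real.cosh (l * p.1) * Real.cosh (l * p.2) with hw_def
  have hwc : Continuous w := by fun_prop
  have hw1 : ∀ p, 1 ≤ w p := fun p =>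
    one_le_mul_of_one_le_of_one_le (Real.one_le_cosh _) (Real.one_le_cosh _)
  have hw0 : ∀ p, 0 < w p := fun p => one_pos.trans_le (hw1 p)
  let E := BoundedContinuousFunction (ℝ × ℝ) ℝ
  have hGc : ∀ Z : E, Continuous fun p => F p + k p * (w p * Z p) := fun Z => by
    have := Z.continuous
    fun_prop
  have hGb : ∀ (Z : E) p, |F p + k p * (w p * Z p)| ≤ (C + K * ‖Z‖) * w p := by
    intro Z p
    have h1 : |k p * (w p * Z p)| ≤ K * (w p * ‖Z‖) := by
      rw [abs_mul, abs_mul, abs_of_pos (hw0 p)]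
      have hZ : |Z p| ≤ ‖Z‖ := Z.norm_coe_le_norm p
      have := hkb p
      have := (hw0 p).le
      gcongr
    have h2 : |F p| ≤ C * w p := (hFb p).trans (le_mul_of_one_le_right hC (hw1 p))
    calc _ ≤ |F p| + |k p * (w p * Z p)| := abs_add_le _ _
      _ ≤ _ := by linarith
  let T : E → E := fun Z => BoundedContinuousFunction.ofNormedAddCommGroup
    (fun p => primFst (primSnd fun p => F p + k p * (w p * Z p)) p / w p)
    ((continuous_primFst (continuous_primSnd (hGc Z))).div hwc fun p => (hw0 p).ne')
    ((C + K * ‖Z‖) / l ^ 2) (fun p => by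
      rw [Real.norm_eq_abs, abs_div, abs_of_pos (hw0 p), div_le_iff₀ (hw0 p)]
      exact abs_primFst_primSnd_le hl (by positivity) (hGb Z) p)
  have hT : ∀ Z p, T Z p = primFst (primSnd fun p => F p + k p * (w p * Z p)) p / w p :=
    fun _ _ => rfl
  have hTc : ContractingWith (1 / 2) T := by
    refine ⟨by norm_num, LipschitzWith.of_dist_le_mul fun Z Y => ?_⟩
    rw [BoundedContinuousFunction.dist_le (by positivity)]
    intro p
    rw [hT, hT, Real.dist_eq, ← sub_div, primFst_primSnd_sub (hGc Z) (hGc Y), abs_div,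
      abs_of_pos (hw0 p), div_le_iff₀ (hw0 p)]
    have h1 : ∀ p, |F p + k p * (w p * Z p) - (F p + k p * (w p * Y p))|
        ≤ K * dist Z Y * w p := by
      intro p
      have : F p + k p * (w p * Z p) - (F p + k p * (w p * Y p)) = k p * (Z p - Y p) * w p := by
        ring
      rw [this, abs_mul, abs_mul, abs_of_pos (hw0 p)]
      have h2 : |Z p - Y p| ≤ dist Z Y := Z.dist_coe_le_dist p
      have := hkb p
      have := (hw0 p).le
      gcongr
    refine (abs_primFst_primSnd_le hl (by positivity) h1 p).trans ?_
    have h3 : K * dist Z Y / l ^ 2 ≤ (1 / 2) * dist Z Y := by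
      rw [div_le_iff₀ (by positivity), hl_def]
      nlinarith [mul_nonneg (sq_nonneg K) (dist_nonneg (x := Z) (y := Y)),
        dist_nonneg (x := Z) (y := Y)]
    have := (hw0 p).le
    simpa using mul_le_mul_of_nonneg_right h3 this
  obtain ⟨Z, hZ, hlim, -⟩ := hTc.exists_fixedPoint (0 : E) (edist_ne_top _ _)
  have hW : ∀ p, w p * Z p = primFst (primSnd fun p => F p + k p * (w p * Z p)) p := by
    intro p
    have : T Z p = Z p := by rw [hZ.eq]
    rw [hT, div_eq_iff (hw0 p).ne'] at this
    rw [this, mul_comm]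
  refine ⟨fun p => w p * Z p, hwc.mul Z.continuous, hW, fun hF0 p hp => ?_⟩
  -- Vanishing passes to the limit of the Picard iterates started at `0`: from a point with `s ≥ 0`
  -- or `r ≥ 0`, the iterated integral only meets points of the same region.
  have hn : ∀ n : ℕ, ∀ p : ℝ × ℝ, 0 ≤ p.1 ∨ 0 ≤ p.2 → (T^[n] 0) p = 0 := by
    intro n
    induction n with
    | zero => intro p _; rfl
    | succ n ih =>
      intro p hp
      rw [Function.iterate_succ_apply', hT, primFst_primSnd_eq_zero _ p hp, zero_div]
      intro p hp
      rw [hF0 p hp, ih p hp]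
      ring
  have : Tendsto (fun n => (T^[n] 0) p) atTop (𝓝 (Z p)) :=
    ((by fun_prop : Continuous fun Y : E => Y p).tendsto Z).comp hlim
  simp only [fun n => hn n p hp] at this
  change w p * Z p = 0
  rw [← tendsto_nhds_unique tendsto_const_nhds this, mul_zero]

/-! ### Partial derivatives, the Goursat problem and Green's identity. -/

/-- The first partial derivative of a function of two real variables. -/
noncomputable def pd₁ (g : ℝ × ℝ → ℝ) (p : ℝ × ℝ) : ℝ := fderiv ℝ g p (1, 0)

/-- The second partial derivative of a function of two real variables. -/
noncomputable def pd₂ (g : ℝ × ℝ → ℝ) (p : ℝ × ℝ) : ℝ := fderiv ℝ g p (0, 1)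

theorem hasDerivAt_pd₁ {g : ℝ × ℝ → ℝ} (hg : ContDiff ℝ 1 g) (x y : ℝ) :
    HasDerivAt (fun s => g (s, y)) (pd₁ g (x, y)) x :=
  hasDerivAt_fst_of_contDiff hg x y

theorem hasDerivAt_pd₂ {g : ℝ × ℝ → ℝ} (hg : ContDiff ℝ 1 g) (x y : ℝ) :
    HasDerivAt (fun s => g (x, s)) (pd₂ g (x, y)) y :=
  hasDerivAt_snd_of_contDiff hg x y

theorem contDiff_one_pd₁ {g : ℝ × ℝ → ℝ} (hg : ContDiff ℝ 2 g) : ContDiff ℝ 1 (pd₁ g) :=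
  (hg.fderiv_right (by norm_num)).clm_apply contDiff_const

theorem contDiff_one_pd₂ {g : ℝ × ℝ → ℝ} (hg : ContDiff ℝ 2 g) : ContDiff ℝ 1 (pd₂ g) :=
  (hg.fderiv_right (by norm_num)).clm_apply contDiff_const

theorem continuous_pd₁ {g : ℝ × ℝ → ℝ} (hg : ContDiff ℝ 1 g) : Continuous (pd₁ g) :=
  (hg.continuous_fderiv one_ne_zero).clm_apply continuous_const

theorem continuous_pd₂ {g : ℝ × ℝ → ℝ} (hg : ContDiff ℝ 1 g) : Continuous (pd₂ g) :=
  (hg.continuous_fderiv one_ne_zero).clm_apply continuous_const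

/-- The chain rule along a curve in the plane. -/
theorem hasDerivAt_comp_curve {g : ℝ × ℝ → ℝ} (hg : ContDiff ℝ 1 g) {α β : ℝ → ℝ}
    {α' β' x : ℝ} (hα : HasDerivAt α α' x) (hβ : HasDerivAt β β' x) :
    HasDerivAt (fun x => g (α x, β x)) (pd₁ g (α x, β x) * α' + pd₂ g (α x, β x) * β') x := by
  have := (hg.differentiable one_ne_zero (α x, β x)).hasFDerivAt.comp_hasDerivAt x (hα.prodMk hβ)
  refine this.congr_deriv ?_
  have e : ((α', β') : ℝ × ℝ) = α' • (1, 0) + β' • (0, 1) := by simp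
  rw [e, map_add, map_smul, map_smul, smul_eq_mul, smul_eq_mul, pd₁, pd₂]
  ring

/-- The second derivatives commute. -/
theorem pd₁_pd₂_comm {g : ℝ × ℝ → ℝ} (hg : ContDiff ℝ 2 g) (p : ℝ × ℝ) :
    pd₁ (pd₂ g) p = pd₂ (pd₁ g) p := by
  have hd : DifferentiableAt ℝ (fderiv ℝ g) p :=
    (hg.fderiv_right (m := 1) (by norm_num)).differentiable one_ne_zero p
  have hs := (hg.contDiffAt (x := p)).isSymmSndFDerivAt (by simp)
  have h1 : ∀ v w : ℝ × ℝ, fderiv ℝ (fun q => fderiv ℝ g q v) p w = fderiv ℝ (fderiv ℝ g) p w v := by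
    intro v w
    rw [fderiv_clm_apply hd (differentiableAt_const v)]
    simp
  change fderiv ℝ (fun q => fderiv ℝ g q (0, 1)) p (1, 0)
    = fderiv ℝ (fun q => fderiv ℝ g q (1, 0)) p (0, 1)
  rw [h1, h1]
  exact hs _ _

/-- The Goursat problem `∂₂∂₁ W = F + k W` with zero data on two characteristics. -/
theorem exists_goursat {k F : ℝ × ℝ → ℝ} (hk : ContDiff ℝ 1 k) (hF : ContDiff ℝ 1 F) {K C : ℝ}
    (hkb : ∀ p, |k p| ≤ K) (hFb : ∀ p, |F p| ≤ C) (s₀ r₀ : ℝ) :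
    ∃ W : ℝ × ℝ → ℝ, ContDiff ℝ 2 W ∧ (∀ r, W (s₀, r) = 0) ∧ (∀ s, W (s, r₀) = 0) ∧
      (∀ p, pd₂ (pd₁ W) p = F p + k p * W p) ∧
      ((∀ p : ℝ × ℝ, s₀ ≤ p.1 ∨ r₀ ≤ p.2 → F p = 0) →
        ∀ p : ℝ × ℝ, s₀ ≤ p.1 ∨ r₀ ≤ p.2 → W p = 0) := by
  have ht : ContDiff ℝ 1 fun p : ℝ × ℝ => (p.1 + s₀, p.2 + r₀) := by fun_prop
  have ht' : ContDiff ℝ 2 fun p : ℝ × ℝ => (p.1 - s₀, p.2 - r₀) := by fun_prop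
  obtain ⟨W, hWc, hW, hW0⟩ := exists_volterra (hk.comp ht).continuous (hF.comp ht).continuous
    (fun p => hkb _) (fun p => hFb _)
  set G : ℝ × ℝ → ℝ := fun p => (F ∘ fun p : ℝ × ℝ => (p.1 + s₀, p.2 + r₀)) p
    + (k ∘ fun p : ℝ × ℝ => (p.1 + s₀, p.2 + r₀)) p * W p with hG
  have hGc : Continuous G := (hF.comp ht).continuous.add ((hk.comp ht).continuous.mul hWc)
  have hWeq : W = primFst (primSnd G) := funext hW
  -- Bootstrap: `W` continuous makes `G` continuous, so `W` is `C¹`; then `G` is `C¹`, so `W` is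
  -- `C²`.
  have hW1 : ContDiff ℝ 1 W := hWeq ▸ contDiff_one_primFst_primSnd hGc
  have hG1 : ContDiff ℝ 1 G := (hF.comp ht).add ((hk.comp ht).mul hW1)
  have hW2 : ContDiff ℝ 2 W := hWeq ▸ contDiff_two_primFst_primSnd hG1
  set U : ℝ × ℝ → ℝ := fun p => W (p.1 - s₀, p.2 - r₀) with hU
  have hU2 : ContDiff ℝ 2 U := hW2.comp ht'
  have hpd : pd₁ U = fun p => primSnd G (p.1 - s₀, p.2 - r₀) := by
    funext p
    have h1 : HasDerivAt (fun s => U (s, p.2)) (primSnd G (p.1 - s₀, p.2 - r₀)) p.1 := by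
      have := (hasDerivAt_primFst (continuous_primSnd hGc) (p.1 - s₀) (p.2 - r₀)).comp_sub_const
        p.1 s₀
      simpa only [hU, hWeq] using this
    exact (hasDerivAt_pd₁ (hU2.of_le (by norm_num)) p.1 p.2).unique h1
  refine ⟨U, hU2, fun r => ?_, fun s => ?_, fun p => ?_, fun h p hp => ?_⟩
  · simp [hU, hWeq, primFst]
  · simp [hU, hWeq, primFst, primSnd]
  · have h1 := (hasDerivAt_primSnd hGc (p.1 - s₀) (p.2 - r₀)).comp_sub_const p.2 r₀
    have h2 := hasDerivAt_pd₂ (contDiff_one_pd₁ hU2) p.1 p.2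
    rw [hpd] at h2 ⊢
    rw [h2.unique h1]
    simp [hG, hU]
  · refine hW0 (fun q hq => h _ ?_) _ ?_
    · simpa using hq
    · simpa using hp

/-- Green's identity on a characteristic rectangle. -/
theorem green_rectangle {k F V W : ℝ × ℝ → ℝ} (hV : ContDiff ℝ 2 V) (hW : ContDiff ℝ 2 W)
    {v S R : ℝ} (hV1 : ∀ r, V (0, r) = v) (hV2 : ∀ s, V (s, 0) = v)
    (hVk : ∀ p, pd₂ (pd₁ V) p = k p * V p)
    (hW1 : ∀ r, W (S, r) = 0) (hW2 : ∀ s, W (s, R) = 0)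
    (hWk : ∀ p, pd₂ (pd₁ W) p = F p + k p * W p) :
    ∫ s in (0 : ℝ)..S, ∫ r in (0 : ℝ)..R, V (s, r) * F (s, r) = v * W (0, 0) := by
  have hV' : ContDiff ℝ 1 V := hV.of_le (by norm_num)
  have hW' : ContDiff ℝ 1 W := hW.of_le (by norm_num)
  have hVx := contDiff_one_pd₁ hV
  have hWx := contDiff_one_pd₁ hW
  have hVr := contDiff_one_pd₂ hV
  have hWs : ∀ s, pd₁ W (s, R) = 0 := fun s => by
    refine (hasDerivAt_pd₁ hW' s R).unique ?_
    simpa only [hW2] using hasDerivAt_const s (0 : ℝ)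
  have hVr0 : ∀ r, pd₂ V (0, r) = 0 := fun r => by
    refine (hasDerivAt_pd₂ hV' 0 r).unique ?_
    simpa only [hV1] using hasDerivAt_const r v
  have c0 := hV'.continuous
  have c1 := hW'.continuous
  have c2 := continuous_pd₁ hV'
  have c3 := continuous_pd₁ hW'
  have c4 := continuous_pd₂ hV'
  have c5 := continuous_pd₂ hW'
  have c6 := continuous_pd₂ hWx
  have c7 := continuous_pd₁ hVr
  -- `V F = V W_sr - V_sr W = ∂_r (V W_s) - ∂_s (V_r W)`. The second divergence integrates to zero,
  -- and the first leaves only the side `r = 0`.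
  have e : ∀ s r, V (s, r) * F (s, r)
      = (pd₂ V (s, r) * pd₁ W (s, r) + V (s, r) * pd₂ (pd₁ W) (s, r))
        - (pd₁ (pd₂ V) (s, r) * W (s, r) + pd₂ V (s, r) * pd₁ W (s, r)) := fun s r => by
    rw [pd₁_pd₂_comm hV, hVk, hWk]
    ring
  have i1 : ∀ s, ∫ r in (0 : ℝ)..R, (pd₂ V (s, r) * pd₁ W (s, r) + V (s, r) * pd₂ (pd₁ W) (s, r))
      = - v * pd₁ W (s, 0) := fun s => by
    rw [intervalIntegral.integral_eq_sub_of_hasDerivAt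
      (fun r _ => (hasDerivAt_pd₂ hV' s r).mul (hasDerivAt_pd₂ hWx s r))
      (by apply Continuous.intervalIntegrable; fun_prop)]
    simp [hWs, hV2]
  have i2 : ∀ r, ∫ s in (0 : ℝ)..S, (pd₁ (pd₂ V) (s, r) * W (s, r) + pd₂ V (s, r) * pd₁ W (s, r))
      = 0 := fun r => by
    rw [intervalIntegral.integral_eq_sub_of_hasDerivAt
      (fun s _ => (hasDerivAt_pd₁ hVr s r).mul (hasDerivAt_pd₁ hW' s r))
      (by apply Continuous.intervalIntegrable; fun_prop)]
    simp [hW1, hVr0]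
  have i3 : ∫ s in (0 : ℝ)..S, ∫ r in (0 : ℝ)..R,
      (pd₁ (pd₂ V) (s, r) * W (s, r) + pd₂ V (s, r) * pd₁ W (s, r)) = 0 := by
    rw [intervalIntegral_intervalIntegral_swap]
    · simp only [i2, intervalIntegral.integral_zero]
    · refine (ContinuousOn.integrableOn_compact (isCompact_uIcc.prod isCompact_uIcc)
        (Continuous.continuousOn ?_)).mono_set (prod_mono uIoc_subset_uIcc uIoc_subset_uIcc)
      simp only [Function.uncurry_def]
      fun_prop
  have i4 : ∀ s, ∫ r in (0 : ℝ)..R, V (s, r) * F (s, r) = - v * pd₁ W (s, 0)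
      - ∫ r in (0 : ℝ)..R,
        (pd₁ (pd₂ V) (s, r) * W (s, r) + pd₂ V (s, r) * pd₁ W (s, r)) := fun s => by
    rw [← i1 s, ← intervalIntegral.integral_sub (by apply Continuous.intervalIntegrable; fun_prop)
      (by apply Continuous.intervalIntegrable; fun_prop)]
    simp only [e]
  simp only [i4]
  rw [intervalIntegral.integral_sub (by apply Continuous.intervalIntegrable; fun_prop)
    (by apply Continuous.intervalIntegrable; fun_prop), i3, intervalIntegral.integral_const_mul,
    intervalIntegral.integral_eq_sub_of_hasDerivAt (fun s _ => hasDerivAt_pd₁ hW' s 0)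
      (by apply Continuous.intervalIntegrable; fun_prop), hW1]
  ring

/-! ### Mollification and test functions of class `C²`. -/

theorem iteratedDeriv_two_fst {φ : ℝ × ℝ → ℝ} (hφ : ContDiff ℝ 2 φ) (x t : ℝ) :
    iteratedDeriv 2 (fun x => φ (x, t)) x = pd₁ (pd₁ φ) (x, t) := by
  have h1 : deriv (fun x => φ (x, t)) = fun x => pd₁ φ (x, t) :=
    funext fun x => (hasDerivAt_pd₁ (hφ.of_le (by norm_num)) x t).deriv
  rw [iteratedDeriv_succ, iteratedDeriv_one, h1]
  exact (hasDerivAt_pd₁ (contDiff_one_pd₁ hφ) x t).deriv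

theorem iteratedDeriv_two_snd {φ : ℝ × ℝ → ℝ} (hφ : ContDiff ℝ 2 φ) (x t : ℝ) :
    iteratedDeriv 2 (fun t => φ (x, t)) t = pd₂ (pd₂ φ) (x, t) := by
  have h1 : deriv (fun t => φ (x, t)) = fun t => pd₂ φ (x, t) :=
    funext fun t => (hasDerivAt_pd₂ (hφ.of_le (by norm_num)) x t).deriv
  rw [iteratedDeriv_succ, iteratedDeriv_one, h1]
  exact (hasDerivAt_pd₂ (contDiff_one_pd₂ hφ) x t).deriv

open scoped Convolution in
theorem fderiv_convolution_apply {ρ g : ℝ × ℝ → ℝ} (hρ : LocallyIntegrable ρ volume)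
    (hg : ContDiff ℝ 1 g) (hgc : HasCompactSupport g) (p v : ℝ × ℝ) :
    fderiv ℝ (ρ ⋆[ContinuousLinearMap.lsmul ℝ ℝ, volume] g) p v
      = (ρ ⋆[ContinuousLinearMap.lsmul ℝ ℝ, volume] fun q => fderiv ℝ g q v) p := by
  rw [(hgc.hasFDerivAt_convolution_right (ContinuousLinearMap.lsmul ℝ ℝ) hρ hg p).fderiv,
    convolution_def, convolution_def, ContinuousLinearMap.integral_apply]
  · rfl
  · exact ((hgc.fderiv ℝ).convolutionExists_right _ hρ (hg.continuous_fderiv one_ne_zero)) p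

theorem hasCompactSupport_pd₁ {g : ℝ × ℝ → ℝ} (hg : HasCompactSupport g) :
    HasCompactSupport (pd₁ g) :=
  (hg.fderiv ℝ).comp_left (g := fun L : ℝ × ℝ →L[ℝ] ℝ => L (1, 0)) (by simp)

theorem hasCompactSupport_pd₂ {g : ℝ × ℝ → ℝ} (hg : HasCompactSupport g) :
    HasCompactSupport (pd₂ g) :=
  (hg.fderiv ℝ).comp_left (g := fun L : ℝ × ℝ →L[ℝ] ℝ => L (0, 1)) (by simp)

open scoped Convolution in
theorem pd₁_pd₁_convolution {ρ g : ℝ × ℝ → ℝ} (hρ : LocallyIntegrable ρ volume)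
    (hg : ContDiff ℝ 2 g) (hgc : HasCompactSupport g) :
    pd₁ (pd₁ (ρ ⋆[ContinuousLinearMap.lsmul ℝ ℝ, volume] g))
      = ρ ⋆[ContinuousLinearMap.lsmul ℝ ℝ, volume] pd₁ (pd₁ g) := by
  have h1 : pd₁ (ρ ⋆[ContinuousLinearMap.lsmul ℝ ℝ, volume] g)
      = ρ ⋆[ContinuousLinearMap.lsmul ℝ ℝ, volume] pd₁ g :=
    funext fun p => fderiv_convolution_apply hρ (hg.of_le (by norm_num)) hgc p _
  rw [h1]
  exact funext fun p => fderiv_convolution_apply hρ (contDiff_one_pd₁ hg)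
    (hasCompactSupport_pd₁ hgc) p _

open scoped Convolution in
theorem pd₂_pd₂_convolution {ρ g : ℝ × ℝ → ℝ} (hρ : LocallyIntegrable ρ volume)
    (hg : ContDiff ℝ 2 g) (hgc : HasCompactSupport g) :
    pd₂ (pd₂ (ρ ⋆[ContinuousLinearMap.lsmul ℝ ℝ, volume] g))
      = ρ ⋆[ContinuousLinearMap.lsmul ℝ ℝ, volume] pd₂ (pd₂ g) := by
  have h1 : pd₂ (ρ ⋆[ContinuousLinearMap.lsmul ℝ ℝ, volume] g)
      = ρ ⋆[ContinuousLinearMap.lsmul ℝ ℝ, volume] pd₂ g :=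
    funext fun p => fderiv_convolution_apply hρ (hg.of_le (by norm_num)) hgc p _
  rw [h1]
  exact funext fun p => fderiv_convolution_apply hρ (contDiff_one_pd₂ hg)
    (hasCompactSupport_pd₂ hgc) p _

-- A normed bump averages `g` over a ball of radius at most `1`. Hence the sup bound survives and
-- the support grows by at most `1`, uniformly in the bump; this provides the domination when the
-- mollifier shrinks.
open scoped Convolution in
theorem exists_mollification_bound {g : ℝ × ℝ → ℝ} (hg : Continuous g)
    (hgc : HasCompactSupport g) : ∃ R C : ℝ, 0 ≤ C ∧ ∀ ρ : ContDiffBump (0 : ℝ × ℝ),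
      ρ.rOut ≤ 1 → ∀ p, |(ρ.normed volume ⋆[ContinuousLinearMap.lsmul ℝ ℝ, volume] g) p|
        ≤ (Metric.closedBall 0 R).indicator (fun _ => C) p := by
  obtain ⟨R, hR⟩ := hgc.isBounded.subset_closedBall 0
  obtain ⟨C, hC⟩ := hgc.exists_bound_of_continuous hg
  have hC0 : 0 ≤ C := (norm_nonneg _).trans (hC 0)
  refine ⟨R + 1, C, hC0, fun ρ hρ p => ?_⟩
  have key : ∀ δ : ℝ, 0 ≤ δ → (∀ x ∈ Metric.ball p ρ.rOut, dist (g x) 0 ≤ δ) →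
      |(ρ.normed volume ⋆[ContinuousLinearMap.lsmul ℝ ℝ, volume] g) p| ≤ δ := by
    intro δ hδ h
    have := dist_convolution_le (μ := volume) hδ ρ.support_normed_eq.subset ρ.nonneg_normed
      ρ.integral_normed hg.aestronglyMeasurable h
    simpa using this
  by_cases hp : p ∈ Metric.closedBall (0 : ℝ × ℝ) (R + 1)
  · rw [indicator_of_mem hp]
    exact key C hC0 fun x _ => by simpa using hC x
  · rw [indicator_of_notMem hp]
    refine key 0 le_rfl fun x hx => ?_
    have : g x = 0 := by
      by_contra hne
      have h1 := hR (subset_tsupport _ hne)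
      rw [Metric.mem_closedBall] at h1 hp
      rw [Metric.mem_ball] at hx
      have := dist_triangle_left p 0 x
      linarith
    simp [this]

open scoped Convolution in
/-- The weak formulation holds for all compactly supported test functions of class `C²`. -/
theorem IsWeakWaveSolution.weak_eq_of_contDiff_two {c : ℝ → ℝ} {u : ℝ → ℝ → ℝ}
    (hc : Continuous c) (hu : IsWeakWaveSolution c u) {φ : ℝ × ℝ → ℝ} (hφ : ContDiff ℝ 2 φ)
    (hφc : HasCompactSupport φ) :
    ∫ p in (univ : Set ℝ) ×ˢ Ioi (0 : ℝ),
      u p.1 p.2 * (c p.1 * pd₂ (pd₂ φ) p - pd₁ (pd₁ φ) p) = c 0 * φ (0, 0) := by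
  have hφt := continuous_pd₂ (contDiff_one_pd₂ hφ)
  have hφx := continuous_pd₁ (contDiff_one_pd₁ hφ)
  obtain ⟨R₁, C₁, hC₁, hb₁⟩ := exists_mollification_bound hφt
    (hasCompactSupport_pd₂ (hasCompactSupport_pd₂ hφc))
  obtain ⟨R₂, C₂, hC₂, hb₂⟩ := exists_mollification_bound hφx
    (hasCompactSupport_pd₁ (hasCompactSupport_pd₁ hφc))
  set K : Set (ℝ × ℝ) := Metric.closedBall 0 (max R₁ R₂) with hK
  have hKc : IsCompact K := isCompact_closedBall _ _
  obtain ⟨D, hD⟩ := hKc.exists_bound_of_continuousOn (hc.comp continuous_fst).continuousOn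
  set ρ : ℕ → ContDiffBump (0 : ℝ × ℝ) := fun n =>
    ⟨1 / (2 * (n + 1)), 1 / (n + 1), by positivity, by
      apply one_div_lt_one_div_of_lt <;> linarith [(Nat.cast_nonneg n : (0 : ℝ) ≤ n)]⟩ with hρ
  have hρ1 : ∀ n, (ρ n).rOut ≤ 1 := fun n => by
    simp only [hρ]
    rw [div_le_one (by positivity)]
    linarith [(Nat.cast_nonneg n : (0 : ℝ) ≤ n)]
  have hρ0 : Tendsto (fun n => (ρ n).rOut) atTop (𝓝 0) := tendsto_one_div_add_atTop_nhds_zero_nat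
  have hρi : ∀ n, LocallyIntegrable ((ρ n).normed volume) volume := fun n =>
    ((ρ n).continuous_normed).locallyIntegrable
  set φn : ℕ → ℝ × ℝ → ℝ := fun n =>
    (ρ n).normed volume ⋆[ContinuousLinearMap.lsmul ℝ ℝ, volume] φ with hφn
  have hφs : ∀ n, ContDiff ℝ ∞ (φn n) := fun n =>
    (ρ n).hasCompactSupport_normed.contDiff_convolution_left _ (ρ n).contDiff_normed
      hφ.continuous.locallyIntegrable
  have hφsc : ∀ n, HasCompactSupport (φn n) := fun n =>
    (ρ n).hasCompactSupport_normed.convolution _ hφc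
  have heq : ∀ n, ∫ p in (univ : Set ℝ) ×ˢ Ioi (0 : ℝ),
      u p.1 p.2 * (c p.1 * pd₂ (pd₂ (φn n)) p - pd₁ (pd₁ (φn n)) p) = c 0 * φn n (0, 0) := by
    intro n
    rw [← hu.weak_eq _ (hφs n) (hφsc n)]
    have h2 : ContDiff ℝ 2 (φn n) := by exact_mod_cast contDiff_infty.1 (hφs n) 2
    simp only [iteratedDeriv_two_fst h2, iteratedDeriv_two_snd h2]
  have hlim1 : Tendsto (fun n => c 0 * φn n (0, 0)) atTop (𝓝 (c 0 * φ (0, 0))) :=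
    (ContDiffBump.convolution_tendsto_right_of_continuous hρ0 hφ.continuous _).const_mul _
  refine tendsto_nhds_unique ?_ hlim1
  simp only [← heq]
  have hum : AEStronglyMeasurable (fun p : ℝ × ℝ => u p.1 p.2)
      (volume.restrict ((univ : Set ℝ) ×ˢ Ioi (0 : ℝ))) :=
    hu.locallyIntegrable.aestronglyMeasurable.mono_measure
      (Measure.restrict_mono (Set.prod_mono le_rfl Ioi_subset_Ici_self) le_rfl)
  refine tendsto_integral_of_dominated_convergence
    (K.indicator fun p => |u p.1 p.2| * (D * C₁ + C₂)) (fun n => ?_) ?_ (fun n => ?_) ?_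
  · have h2 : ContDiff ℝ 2 (φn n) := by exact_mod_cast contDiff_infty.1 (hφs n) 2
    have := continuous_pd₂ (contDiff_one_pd₂ h2)
    have := continuous_pd₁ (contDiff_one_pd₁ h2)
    exact hum.mul (by fun_prop : Continuous fun p : ℝ × ℝ =>
      c p.1 * pd₂ (pd₂ (φn n)) p - pd₁ (pd₁ (φn n)) p).aestronglyMeasurable
  · rw [integrable_indicator_iff hKc.measurableSet, IntegrableOn,
      Measure.restrict_restrict hKc.measurableSet]
    -- Local integrability up to the closed boundary `t = 0` is essential, as the test functions
    -- need not vanish there.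
    have h1 : IntegrableOn (fun p : ℝ × ℝ => u p.1 p.2) (K ∩ (univ ×ˢ Ici 0)) volume :=
      hu.locallyIntegrable.integrableOn_compact_subset inter_subset_right
        (hKc.inter_right (isClosed_univ.prod isClosed_Ici))
    exact ((h1.mono_set (inter_subset_inter_right _
      (Set.prod_mono le_rfl Ioi_subset_Ici_self))).abs).mul_const _
  · refine Eventually.of_forall fun p => ?_
    rw [pd₂_pd₂_convolution (hρi n) hφ hφc, pd₁_pd₁_convolution (hρi n) hφ hφc]
    have h1 := hb₁ (ρ n) (hρ1 n) p
    have h2 := hb₂ (ρ n) (hρ1 n) p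
    rw [Real.norm_eq_abs, abs_mul]
    by_cases hp : p ∈ K
    · rw [indicator_of_mem hp]
      have h1' := h1.trans (indicator_le_self' (fun _ _ => hC₁) p)
      have h2' := h2.trans (indicator_le_self' (fun _ _ => hC₂) p)
      have h3 : |c p.1| ≤ D := hD p hp
      gcongr
      refine (abs_sub _ _).trans ?_
      rw [abs_mul]
      gcongr
      exact (abs_nonneg _).trans h3
    · have e : ∀ R ≤ max R₁ R₂, p ∉ Metric.closedBall (0 : ℝ × ℝ) R := fun R hR h =>
        hp (Metric.closedBall_subset_closedBall hR h)
      rw [indicator_of_notMem hp]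
      rw [indicator_of_notMem (e _ (le_max_left _ _)), abs_nonpos_iff] at h1
      rw [indicator_of_notMem (e _ (le_max_right _ _)), abs_nonpos_iff] at h2
      rw [h1, h2]
      simp
  · refine Eventually.of_forall fun p => ?_
    simp only [fun n => pd₂_pd₂_convolution (hρi n) hφ hφc,
      fun n => pd₁_pd₁_convolution (hρi n) hφ hφc, hφn]
    exact (((ContDiffBump.convolution_tendsto_right_of_continuous hρ0 hφt p).const_mul _).sub
      (ContDiffBump.convolution_tendsto_right_of_continuous hρ0 hφx p)).const_mul _

/-! ### The coefficient, its amplitude and the travel time. -/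

/-- The standing assumptions on the coefficient `c`. -/
structure IsRegularCoefficient (c : ℝ → ℝ) (ε M : ℝ) : Prop where
  contDiff : ContDiff ℝ 3 c
  pos_left : 0 < ε
  lt : ε < M
  exists_lower_bound : ∃ m, 0 < m ∧ ∀ x, m ≤ c x
  eq_one : ∀ x, x ∉ Icc ε M → c x = 1

/-- The amplitude `c^(-1/4)` of the wave front. -/
noncomputable def amplitude (c : ℝ → ℝ) (x : ℝ) : ℝ := (c x) ^ (-(1 / 4) : ℝ)

namespace IsRegularCoefficient

variable {c : ℝ → ℝ} {ε M : ℝ}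

theorem pos (h : IsRegularCoefficient c ε M) (x : ℝ) : 0 < c x :=
  let ⟨_, h0, hm⟩ := h.exists_lower_bound
  h0.trans_le (hm x)

theorem amplitude_pos (h : IsRegularCoefficient c ε M) (x : ℝ) : 0 < amplitude c x :=
  Real.rpow_pos_of_pos (h.pos x) _

theorem contDiff_amplitude (h : IsRegularCoefficient c ε M) : ContDiff ℝ 3 (amplitude c) :=
  h.contDiff.rpow_const_of_ne fun x => (h.pos x).ne'

theorem amplitude_pow_four (h : IsRegularCoefficient c ε M) (x : ℝ) :
    amplitude c x ^ 4 = (c x)⁻¹ := by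
  rw [amplitude, ← Real.rpow_natCast, ← Real.rpow_mul (h.pos x).le, ← Real.rpow_neg_one]
  norm_num

theorem sqrt_eq (h : IsRegularCoefficient c ε M) (x : ℝ) :
    √(c x) = (amplitude c x ^ 2)⁻¹ := by
  have h0 := h.amplitude_pos x
  rw [Real.sqrt_eq_iff_mul_self_eq (h.pos x).le (by positivity), ← mul_inv, ← pow_add,
    h.amplitude_pow_four, inv_inv]

theorem eq_amplitude (h : IsRegularCoefficient c ε M) (x : ℝ) :
    c x = (amplitude c x ^ 4)⁻¹ := by
  rw [h.amplitude_pow_four, inv_inv]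

theorem hasDerivAt_travelTime (h : IsRegularCoefficient c ε M) (x : ℝ) :
    HasDerivAt (travelTime c) (amplitude c x ^ 2)⁻¹ x := by
  have hc : Continuous fun s => √(c s) := h.contDiff.continuous.sqrt
  rw [← h.sqrt_eq]
  exact intervalIntegral.integral_hasDerivAt_right (hc.intervalIntegrable _ _)
    (hc.stronglyMeasurableAtFilter _ _) hc.continuousAt

theorem contDiff_travelTime (h : IsRegularCoefficient c ε M) : ContDiff ℝ 3 (travelTime c) := by
  have hd : deriv (travelTime c) = fun x => (amplitude c x ^ 2)⁻¹ :=
    funext fun x => (h.hasDerivAt_travelTime x).deriv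
  have : ContDiff ℝ (2 + 1) (travelTime c) := by
    rw [contDiff_succ_iff_deriv, hd]
    refine ⟨fun x => (h.hasDerivAt_travelTime x).differentiableAt, by simp, ?_⟩
    exact ((h.contDiff_amplitude.of_le (by norm_num)).pow 2).inv
      fun x => (pow_pos (h.amplitude_pos x) 2).ne'
  norm_num at this
  exact this

theorem continuous_travelTime (h : IsRegularCoefficient c ε M) : Continuous (travelTime c) :=
  h.contDiff_travelTime.continuous

theorem strictMono_travelTime (h : IsRegularCoefficient c ε M) : StrictMono (travelTime c) :=
  strictMono_of_deriv_pos fun x => by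
    rw [(h.hasDerivAt_travelTime x).deriv]
    exact inv_pos.2 (pow_pos (h.amplitude_pos x) 2)

theorem travelTime_zero (c : ℝ → ℝ) : travelTime c 0 = 0 := by simp [travelTime]

theorem travelTime_nonneg (h : IsRegularCoefficient c ε M) {x : ℝ} (hx : 0 ≤ x) :
    0 ≤ travelTime c x := by
  rw [← travelTime_zero c]
  exact h.strictMono_travelTime.monotone hx

/-- The slope of `τ` is at least `√m > 0`, which forces `τ → ±∞`. -/
theorem surjective_travelTime (h : IsRegularCoefficient c ε M) :
    Function.Surjective (travelTime c) := by
  obtain ⟨m, hm, hmc⟩ := h.exists_lower_bound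
  have hd : ∀ x, √m ≤ deriv (travelTime c) x := fun x => by
    rw [(h.hasDerivAt_travelTime x).deriv, ← h.sqrt_eq]
    exact Real.sqrt_le_sqrt (hmc x)
  have hdiff : Differentiable ℝ (travelTime c) := fun x =>
    (h.hasDerivAt_travelTime x).differentiableAt
  have hmv : ∀ x y, x ≤ y → √m * (y - x) ≤ travelTime c y - travelTime c x := fun x y hxy =>
    mul_sub_le_image_sub_of_le_deriv hdiff hd hxy
  have hsm : 0 < √m := Real.sqrt_pos.2 hm
  refine h.continuous_travelTime.surjective ?_ ?_
  · refine tendsto_atTop_mono' _ ?_ (tendsto_id.const_mul_atTop hsm)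
    filter_upwards [eventually_ge_atTop 0] with x hx
    simpa [travelTime_zero] using hmv 0 x hx
  · refine tendsto_atBot_mono' _ ?_ (tendsto_id.const_mul_atBot hsm)
    filter_upwards [eventually_le_atBot 0] with x hx
    simpa [travelTime_zero] using hmv x 0 hx

/-- The integrand is `1` on `(0, ε)`; the endpoint `ε` is a null set. -/
theorem travelTime_eq_self (h : IsRegularCoefficient c ε M) : travelTime c ε = ε := by
  have h1 : travelTime c ε = ∫ s in (0 : ℝ)..ε, (1 : ℝ) := by
    refine intervalIntegral.integral_congr_ae ?_
    have : ∀ᵐ s : ℝ, s ≠ ε := by simp [ae_iff]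
    filter_upwards [this] with s hs hs'
    rw [uIoc_of_le h.pos_left.le] at hs'
    rw [h.eq_one s fun hh => hs (le_antisymm hs'.2 hh.1), Real.sqrt_one]
  simpa using h1

/-- The travel time is a `C¹` diffeomorphism of the line. -/
theorem exists_inverse_travelTime (h : IsRegularCoefficient c ε M) :
    ∃ σ : ℝ → ℝ, ContDiff ℝ 1 σ ∧ (∀ x, σ (travelTime c x) = x) ∧ ∀ y, travelTime c (σ y) = y := by
  let e := h.strictMono_travelTime.orderIsoOfSurjective _ h.surjective_travelTime
  have h1 : ∀ x, e.symm (travelTime c x) = x := fun x => e.symm_apply_apply x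
  have h2 : ∀ y, travelTime c (e.symm y) = y := fun y => e.apply_symm_apply y
  have hcont : Continuous e.symm := e.symm.continuous
  have hd : ∀ y, HasDerivAt e.symm (amplitude c (e.symm y) ^ 2) y := fun y => by
    have := HasDerivAt.of_local_left_inverse hcont.continuousAt
      (h.hasDerivAt_travelTime (e.symm y)) (inv_ne_zero (pow_pos (h.amplitude_pos _) 2).ne')
      (Eventually.of_forall h2)
    rwa [inv_inv] at this
  refine ⟨e.symm, ?_, h1, h2⟩
  rw [contDiff_one_iff_deriv]
  refine ⟨fun y => (hd y).differentiableAt, ?_⟩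
  rw [show deriv e.symm = fun y => amplitude c (e.symm y) ^ 2 from funext fun y => (hd y).deriv]
  exact (h.contDiff_amplitude.continuous.comp hcont).pow 2

theorem amplitude_eq_one (h : IsRegularCoefficient c ε M) {x : ℝ} (hx : x ∉ Icc ε M) :
    amplitude c x = 1 := by
  rw [amplitude, h.eq_one x hx, Real.one_rpow]

theorem amplitude_zero (h : IsRegularCoefficient c ε M) : amplitude c 0 = 1 :=
  h.amplitude_eq_one fun hh => h.pos_left.not_ge hh.1

theorem contDiff_deriv_amplitude (h : IsRegularCoefficient c ε M) :
    ContDiff ℝ 2 (deriv (amplitude c)) := by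
  have : ContDiff ℝ (2 + 1) (amplitude c) := by norm_num; exact h.contDiff_amplitude
  exact (contDiff_succ_iff_deriv.1 this).2.2

theorem contDiff_deriv_deriv_amplitude (h : IsRegularCoefficient c ε M) :
    ContDiff ℝ 1 (deriv (deriv (amplitude c))) := by
  have : ContDiff ℝ (1 + 1) (deriv (amplitude c)) := by
    norm_num; exact h.contDiff_deriv_amplitude
  exact (contDiff_succ_iff_deriv.1 this).2.2

theorem hasDerivAt_amplitude (h : IsRegularCoefficient c ε M) (x : ℝ) :
    HasDerivAt (amplitude c) (deriv (amplitude c) x) x :=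
  (h.contDiff_amplitude.differentiable (by norm_num) x).hasDerivAt

theorem hasDerivAt_deriv_amplitude (h : IsRegularCoefficient c ε M) (x : ℝ) :
    HasDerivAt (deriv (amplitude c)) (deriv (deriv (amplitude c)) x) x :=
  (h.contDiff_deriv_amplitude.differentiable (by norm_num) x).hasDerivAt

theorem deriv_amplitude_eq_zero (h : IsRegularCoefficient c ε M) {x : ℝ} (hx : x ∉ Icc ε M) :
    deriv (amplitude c) x = 0 := by
  have : amplitude c =ᶠ[𝓝 x] fun _ => 1 := by
    filter_upwards [isClosed_Icc.isOpen_compl.mem_nhds hx] with y hy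
    exact h.amplitude_eq_one hy
  rw [this.deriv_eq, deriv_const]

theorem deriv_deriv_amplitude_eq_zero (h : IsRegularCoefficient c ε M) {x : ℝ}
    (hx : x ∉ Icc ε M) : deriv (deriv (amplitude c)) x = 0 := by
  have : deriv (amplitude c) =ᶠ[𝓝 x] fun _ => 0 := by
    filter_upwards [isClosed_Icc.isOpen_compl.mem_nhds hx] with y hy
    exact h.deriv_amplitude_eq_zero hy
  rw [this.deriv_eq, deriv_const]

/-- The point is the endpoint `x = M`, reached by continuity from `x > M`. -/
theorem deriv_amplitude_eq_zero_of_le (h : IsRegularCoefficient c ε M) {x : ℝ} (hx : M ≤ x) :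
    deriv (amplitude c) x = 0 := by
  have : EqOn (deriv (amplitude c)) (fun _ => 0) (closure (Ioi M)) :=
    EqOn.closure (fun y hy => h.deriv_amplitude_eq_zero fun hh => hy.not_ge hh.2)
      h.contDiff_deriv_amplitude.continuous continuous_const
  rw [closure_Ioi] at this
  exact this hx

theorem deriv_deriv_amplitude_eq_zero_of_le (h : IsRegularCoefficient c ε M) {x : ℝ}
    (hx : M ≤ x) : deriv (deriv (amplitude c)) x = 0 := by
  have : EqOn (deriv (deriv (amplitude c))) (fun _ => 0) (closure (Ioi M)) :=
    EqOn.closure (fun y hy => h.deriv_deriv_amplitude_eq_zero fun hh => hy.not_ge hh.2)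
      h.contDiff_deriv_deriv_amplitude.continuous continuous_const
  rw [closure_Ioi] at this
  exact this hx

/-! ### The potential and the Liouville transformation. -/

/-- The potential of the wave equation in characteristic coordinates, as a `C¹` bounded function. -/
theorem exists_potential (h : IsRegularCoefficient c ε M) :
    ∃ (k : ℝ × ℝ → ℝ) (K : ℝ), ContDiff ℝ 1 k ∧ (∀ p, |k p| ≤ K) ∧
      (∀ x t, k (t + travelTime c x, t - travelTime c x)
        = amplitude c x ^ 3 * deriv (deriv (amplitude c)) x / 4) ∧
      ∀ p : ℝ × ℝ, 2 * travelTime c M ≤ p.1 - p.2 → k p = 0 := by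
  obtain ⟨σ, hσ, hσ1, hσ2⟩ := h.exists_inverse_travelTime
  set P : ℝ → ℝ := fun x => amplitude c x ^ 3 * deriv (deriv (amplitude c)) x / 4 with hP
  have hPc : ContDiff ℝ 1 P :=
    (((h.contDiff_amplitude.of_le (by norm_num)).pow 3).mul
      h.contDiff_deriv_deriv_amplitude).div_const 4
  have hPs : HasCompactSupport P := HasCompactSupport.intro (isCompact_Icc (a := ε) (b := M))
    fun x hx => by simp [hP, h.deriv_deriv_amplitude_eq_zero hx]
  obtain ⟨K, hK⟩ := hPs.exists_bound_of_continuous hPc.continuous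
  -- The travel time is `(s - r) / 2`, so `x` is recovered by applying the inverse `σ`.
  refine ⟨fun p => P (σ ((p.1 - p.2) / 2)), K, hPc.comp (hσ.comp (by fun_prop)),
    fun p => hK _, fun x t => ?_, fun p hp => ?_⟩
  · have : (t + travelTime c x - (t - travelTime c x)) / 2 = travelTime c x := by ring
    simp only [this, hσ1, hP]
  · have : M ≤ σ ((p.1 - p.2) / 2) := by
      rw [← h.strictMono_travelTime.le_iff_le, hσ2]
      linarith
    simp [hP, h.deriv_deriv_amplitude_eq_zero_of_le this]

theorem contDiff_liouville (h : IsRegularCoefficient c ε M) {Ω : ℝ × ℝ → ℝ}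
    (hΩ : ContDiff ℝ 2 Ω) :
    ContDiff ℝ 2 fun p : ℝ × ℝ =>
      amplitude c p.1 * Ω (p.2 + travelTime c p.1, p.2 - travelTime c p.1) := by
  have h1 : ContDiff ℝ 2 (amplitude c) := h.contDiff_amplitude.of_le (by norm_num)
  have h2 : ContDiff ℝ 2 (travelTime c) := h.contDiff_travelTime.of_le (by norm_num)
  fun_prop

/-- The Liouville transformation: the wave operator in characteristic coordinates. -/
theorem wave_operator_liouville (h : IsRegularCoefficient c ε M) {Ω : ℝ × ℝ → ℝ}
    (hΩ : ContDiff ℝ 2 Ω) {φ : ℝ × ℝ → ℝ}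
    (hφ : ∀ p : ℝ × ℝ, φ p = amplitude c p.1 * Ω (p.2 + travelTime c p.1, p.2 - travelTime c p.1))
    (x t : ℝ) :
    c x * pd₂ (pd₂ φ) (x, t) - pd₁ (pd₁ φ) (x, t)
      = 4 / amplitude c x ^ 3 * pd₂ (pd₁ Ω) (t + travelTime c x, t - travelTime c x)
        - deriv (deriv (amplitude c)) x * Ω (t + travelTime c x, t - travelTime c x) := by
  have hφ2 : ContDiff ℝ 2 φ := by
    rw [show φ = _ from funext hφ]
    exact h.contDiff_liouville hΩ
  have hφ1 := hφ2.of_le (m := 1) (by norm_num)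
  have hΩ0 := hΩ.of_le (m := 1) (by norm_num)
  have hΩ1 := contDiff_one_pd₁ hΩ
  have hΩ2 := contDiff_one_pd₂ hΩ
  have hα : ∀ x t, HasDerivAt (fun x => t + travelTime c x) (amplitude c x ^ 2)⁻¹ x := fun x t =>
    (h.hasDerivAt_travelTime x).const_add t
  have hβ : ∀ x t, HasDerivAt (fun x => t - travelTime c x) (-(amplitude c x ^ 2)⁻¹) x :=
    fun x t => (h.hasDerivAt_travelTime x).const_sub t
  have hα' : ∀ x t, HasDerivAt (fun t => t + travelTime c x) 1 t := fun x t =>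
    (hasDerivAt_id t).add_const _
  have hβ' : ∀ x t, HasDerivAt (fun t => t - travelTime c x) 1 t := fun x t =>
    (hasDerivAt_id t).sub_const _
  have e2 : pd₂ φ = fun p => amplitude c p.1 *
      (pd₁ Ω (p.2 + travelTime c p.1, p.2 - travelTime c p.1)
        + pd₂ Ω (p.2 + travelTime c p.1, p.2 - travelTime c p.1)) := by
    funext ⟨x, t⟩
    have := (hasDerivAt_comp_curve hΩ0 (hα' x t) (hβ' x t)).const_mul (amplitude c x)
    refine (hasDerivAt_pd₂ hφ1 x t).unique ?_
    simp only [hφ]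
    exact this.congr_deriv (by ring)
  -- Here `b τ' = b⁻¹`. On differentiating again, the terms `± b' b⁻² (Ω_s - Ω_r)` cancel; this is
  -- what fixes the exponent `-1/4`.
  have e1 : pd₁ φ = fun p => deriv (amplitude c) p.1 *
      Ω (p.2 + travelTime c p.1, p.2 - travelTime c p.1) + (amplitude c p.1)⁻¹ *
      (pd₁ Ω (p.2 + travelTime c p.1, p.2 - travelTime c p.1)
        - pd₂ Ω (p.2 + travelTime c p.1, p.2 - travelTime c p.1)) := by
    funext ⟨x, t⟩
    have := (h.hasDerivAt_amplitude x).mul (hasDerivAt_comp_curve hΩ0 (hα x t) (hβ x t))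
    refine (hasDerivAt_pd₁ hφ1 x t).unique ?_
    simp only [hφ]
    refine this.congr_deriv ?_
    have := (h.amplitude_pos x).ne'
    field_simp
    ring
  have e22 := ((((hasDerivAt_comp_curve hΩ1 (hα' x t) (hβ' x t)).add
    (hasDerivAt_comp_curve hΩ2 (hα' x t) (hβ' x t))).const_mul (amplitude c x)
    ).congr_of_eventuallyEq (Eventually.of_forall fun s => congrFun e2 (x, s))).unique
      (hasDerivAt_pd₂ (contDiff_one_pd₂ hφ2) x t)
  have e11 := ((((h.hasDerivAt_deriv_amplitude x).mul
    (hasDerivAt_comp_curve hΩ0 (hα x t) (hβ x t))).add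
    (((h.hasDerivAt_amplitude x).inv (h.amplitude_pos x).ne').mul
      ((hasDerivAt_comp_curve hΩ1 (hα x t) (hβ x t)).sub
        (hasDerivAt_comp_curve hΩ2 (hα x t) (hβ x t))))
    ).congr_of_eventuallyEq (Eventually.of_forall fun s => congrFun e1 (s, t))).unique
      (hasDerivAt_pd₁ (contDiff_one_pd₁ hφ2) x t)
  rw [← e11, ← e22, h.eq_amplitude x, pd₁_pd₂_comm hΩ]
  simp only [Pi.sub_apply, Pi.inv_apply]
  have := (h.amplitude_pos x).ne'
  field_simp
  ring

end IsRegularCoefficient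

/-! ### Characteristic coordinates, the Riemann function and duality. -/

namespace IsRegularCoefficient

variable {c : ℝ → ℝ} {ε M : ℝ}

/-- The characteristic coordinates `(t + τ(x), t - τ(x))`. -/
noncomputable def _root_.charCoord (c : ℝ → ℝ) (p : ℝ × ℝ) : ℝ × ℝ :=
  (p.2 + travelTime c p.1, p.2 - travelTime c p.1)

theorem bijective_charCoord (h : IsRegularCoefficient c ε M) : Function.Bijective (charCoord c) := by
  constructor
  · rintro ⟨x, t⟩ ⟨y, s⟩ hxy
    simp only [charCoord, Prod.mk.injEq] at hxy
    have h1 : travelTime c x = travelTime c y := by linarith [hxy.1, hxy.2]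
    have h2 : t = s := by linarith [hxy.1, hxy.2]
    rw [h.strictMono_travelTime.injective h1, h2]
  · rintro ⟨a, b⟩
    obtain ⟨x, hx⟩ := h.surjective_travelTime ((a - b) / 2)
    refine ⟨(x, (a + b) / 2), ?_⟩
    simp only [charCoord, hx, Prod.mk.injEq]
    constructor <;> ring

theorem charCoord_preimage (c : ℝ → ℝ) :
    charCoord c ⁻¹' (Ici 0 ×ˢ Ici 0) = {p | |travelTime c p.1| ≤ p.2} := by
  ext p
  simp only [charCoord, mem_preimage, mem_prod, mem_Ici, mem_ofPred_eq, abs_le]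
  constructor <;> rintro ⟨h1, h2⟩ <;> constructor <;> linarith

theorem hasFDerivAt_charCoord (h : IsRegularCoefficient c ε M) (p : ℝ × ℝ) :
    HasFDerivAt (charCoord c) (Matrix.toLin (.finTwoProd ℝ) (.finTwoProd ℝ)
      !![(amplitude c p.1 ^ 2)⁻¹, 1; -(amplitude c p.1 ^ 2)⁻¹, 1]).toContinuousLinearMap p := by
  rw [Matrix.toLin_finTwoProd_toContinuousLinearMap]
  have h1 : HasFDerivAt (fun p : ℝ × ℝ => travelTime c p.1)
      ((amplitude c p.1 ^ 2)⁻¹ • ContinuousLinearMap.fst ℝ ℝ ℝ) p :=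
    (h.hasDerivAt_travelTime p.1).comp_hasFDerivAt p hasFDerivAt_fst
  have h2 : HasFDerivAt (fun p : ℝ × ℝ => p.2) (ContinuousLinearMap.snd ℝ ℝ ℝ) p :=
    hasFDerivAt_snd
  convert! (h2.add h1).prodMk (h2.sub h1) using 2
  · rw [one_smul, add_comm]
  · module

theorem measurableSet_cone (h : IsRegularCoefficient c ε M) :
    MeasurableSet {p : ℝ × ℝ | |travelTime c p.1| ≤ p.2} :=
  (isClosed_le (h.continuous_travelTime.comp continuous_fst).abs continuous_snd).measurableSet

/-- Change of variables to characteristic coordinates in the light cone. -/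
theorem integral_charCoord (h : IsRegularCoefficient c ε M) (g : ℝ × ℝ → ℝ) :
    ∫ q in Ici (0 : ℝ) ×ˢ Ici (0 : ℝ), g q
      = ∫ p in {p : ℝ × ℝ | |travelTime c p.1| ≤ p.2},
        2 * (amplitude c p.1 ^ 2)⁻¹ * g (charCoord c p) := by
  have := integral_image_eq_integral_abs_det_fderiv_smul volume h.measurableSet_cone
    (fun p _ => (h.hasFDerivAt_charCoord p).hasFDerivWithinAt) h.bijective_charCoord.1.injOn g
  rw [← charCoord_preimage, image_preimage_eq _ h.bijective_charCoord.2] at this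
  rw [this, charCoord_preimage]
  refine setIntegral_congr_fun h.measurableSet_cone fun p _ => ?_
  have hp := h.amplitude_pos p.1
  have hdet : (Matrix.toLin (.finTwoProd ℝ) (.finTwoProd ℝ)
      !![(amplitude c p.1 ^ 2)⁻¹, 1; -(amplitude c p.1 ^ 2)⁻¹, 1]).toContinuousLinearMap.det
      = 2 * (amplitude c p.1 ^ 2)⁻¹ := by
    simp only [LinearMap.det_toContinuousLinearMap, LinearMap.det_toLin, Matrix.det_fin_two_of]
    ring
  simp only [hdet, smul_eq_mul]
  rw [abs_of_pos (by positivity)]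

/-- `k` is the potential of the wave operator in characteristic coordinates, and `V` solves the
Goursat problem `∂₂∂₁ V = k V` with `V = 1 / 2` on the characteristics through the source. -/
structure _root_.IsRiemannFunction (c : ℝ → ℝ) (k V : ℝ × ℝ → ℝ) : Prop where
  contDiff_potential : ContDiff ℝ 1 k
  exists_bound : ∃ K, ∀ p, |k p| ≤ K
  potential_eq : ∀ x t, k (t + travelTime c x, t - travelTime c x)
        = amplitude c x ^ 3 * deriv (deriv (amplitude c)) x / 4
  contDiff : ContDiff ℝ 2 V
  left_eq : ∀ r, V (0, r) = 1 / 2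
  right_eq : ∀ s, V (s, 0) = 1 / 2
  pd_eq : ∀ p, pd₂ (pd₁ V) p = k p * V p

/-- `V - 1/2` solves a Goursat problem with zero data and source `k / 2`. For the last clause, `∂_r
V_s = k V` vanishes on the segment from `(s, 0)` to `(s, r)`, and `V_s = 0` at its start. This
expresses the absence of reflection beyond `M`. -/
theorem exists_isRiemannFunction (h : IsRegularCoefficient c ε M) :
    ∃ k V : ℝ × ℝ → ℝ, IsRiemannFunction c k V ∧
      ∀ s r, 0 ≤ r → 2 * travelTime c M ≤ s - r → pd₁ V (s, r) = 0 := by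
  obtain ⟨k, K, hk, hkK, hkx, hkM⟩ := h.exists_potential
  obtain ⟨W, hW, hW1, hW2, hWk, -⟩ := exists_goursat (F := fun p => k p / 2) (C := K / 2) hk
    (hk.div_const 2) hkK (fun p => by
      rw [abs_div, abs_two]
      exact div_le_div_of_nonneg_right (hkK p) two_pos.le) 0 0
  set V : ℝ × ℝ → ℝ := fun p => 1 / 2 + W p with hVdef
  have hV : ContDiff ℝ 2 V := contDiff_const.add hW
  have hpd : pd₁ V = pd₁ W := funext fun p => by simp [pd₁, hVdef]
  have hVk : ∀ p, pd₂ (pd₁ V) p = k p * V p := fun p => by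
    rw [hpd, hWk]
    ring
  have hV2 : ∀ s, V (s, 0) = 1 / 2 := fun s => by simp [hVdef, hW2]
  refine ⟨k, V, ⟨hk, ⟨K, hkK⟩, hkx, hV, fun r => by simp [hVdef, hW1], hV2, hVk⟩, ?_⟩
  intro s r hr hsr
  have h0 : pd₁ V (s, 0) = 0 := by
    refine (hasDerivAt_pd₁ (hV.of_le (by norm_num)) s 0).unique ?_
    simpa only [hV2] using hasDerivAt_const s (1 / 2 : ℝ)
  have hd := hasDerivAt_pd₂ (contDiff_one_pd₁ hV) s
  rw [← h0]
  refine constant_of_has_deriv_right_zero (f := fun r => pd₁ V (s, r)) (a := 0) (b := r)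
    (fun y _ => (hd y).continuousAt.continuousWithinAt) (fun y hy => ?_) r ⟨hr, le_rfl⟩
  have := (hd y).hasDerivWithinAt (s := Ici y)
  rwa [hVk, hkM (s, y) (by simp only; linarith [hy.2]), zero_mul] at this

/-- The solution with Riemann function `V`, equal to zero ahead of the front. -/
noncomputable def _root_.coneSolution (c : ℝ → ℝ) (V : ℝ × ℝ → ℝ) : ℝ × ℝ → ℝ :=
  {p : ℝ × ℝ | |travelTime c p.1| ≤ p.2}.indicator fun p => amplitude c p.1 * V (charCoord c p)

theorem locallyIntegrable_coneSolution (h : IsRegularCoefficient c ε M) {V : ℝ × ℝ → ℝ}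
    (hV : ContDiff ℝ 2 V) : LocallyIntegrable (coneSolution c V) volume :=
  (h.contDiff_liouville hV).continuous.locallyIntegrable.indicator h.measurableSet_cone

/-- The solution of the adjoint problem with source `ψ`, vanishing after the support of `ψ`. -/
theorem exists_dual_solution (h : IsRegularCoefficient c ε M) {k : ℝ × ℝ → ℝ}
    (hk : ContDiff ℝ 1 k) {K : ℝ} (hkK : ∀ p, |k p| ≤ K)
    {ψ : ℝ × ℝ → ℝ} (hψ : ContDiff ℝ 1 ψ) (hψc : HasCompactSupport ψ) :
    ∃ (R : ℝ) (F W : ℝ × ℝ → ℝ), 0 < R ∧ Continuous F ∧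
      (∀ p, F (charCoord c p) = amplitude c p.1 ^ 3 * ψ p / 4) ∧
      (∀ p : ℝ × ℝ, R ≤ p.1 ∨ R ≤ p.2 → F p = 0) ∧
      ContDiff ℝ 2 W ∧ (∀ p : ℝ × ℝ, R ≤ p.1 ∨ R ≤ p.2 → W p = 0) ∧
      ∀ p, pd₂ (pd₁ W) p = F p + k p * W p := by
  obtain ⟨σ, hσ, hσ1, hσ2⟩ := h.exists_inverse_travelTime
  have hτ := h.continuous_travelTime
  obtain ⟨B, hB⟩ := hψc.exists_bound_of_continuousOn
    (f := fun p : ℝ × ℝ => |p.2| + |travelTime c p.1|) (by fun_prop)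
  -- `R` is positive and strictly exceeds `|t| + |τ(x)|` on the support of `ψ`.
  set R : ℝ := |B| + 1 with hR
  have hψR : ∀ p : ℝ × ℝ, R ≤ p.2 + travelTime c p.1 ∨ R ≤ p.2 - travelTime c p.1 → ψ p = 0 := by
    intro p hp
    by_contra hne
    have h1 := hB p (subset_tsupport _ hne)
    rw [Real.norm_eq_abs, abs_of_nonneg (by positivity)] at h1
    have := le_abs_self B
    have := le_abs_self p.2
    have := le_abs_self (travelTime c p.1)
    have := neg_le_abs (travelTime c p.1)
    rcases hp with hp | hp <;> linarith
  set S : ℝ × ℝ → ℝ × ℝ := fun q => (σ ((q.1 - q.2) / 2), (q.1 + q.2) / 2) with hS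
  have hS1 : ContDiff ℝ 1 S := by fun_prop
  have hS2 : ∀ p, S (charCoord c p) = p := by
    intro p
    have e1 : (p.2 + travelTime c p.1 - (p.2 - travelTime c p.1)) / 2 = travelTime c p.1 := by ring
    have e2 : (p.2 + travelTime c p.1 + (p.2 - travelTime c p.1)) / 2 = p.2 := by ring
    simp only [hS, charCoord, e1, e2, hσ1]
  have hS3 : ∀ q, charCoord c (S q) = q := by
    intro q
    simp only [hS, charCoord, hσ2]
    ext <;> simp only <;> ring
  -- The factor `b³ / 4` cancels the `4 / b³` of the Liouville transformation, so that `b W` has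
  -- wave operator exactly `ψ`.
  set f : ℝ × ℝ → ℝ := fun p => amplitude c p.1 ^ 3 * ψ p / 4 with hf
  have hf1 : ContDiff ℝ 1 f := by
    have : ContDiff ℝ 1 (amplitude c) := h.contDiff_amplitude.of_le (by norm_num)
    fun_prop
  have hfc : HasCompactSupport f := HasCompactSupport.intro hψc fun p hp => by
    simp [hf, image_eq_zero_of_notMem_tsupport hp]
  obtain ⟨C, hC⟩ := hfc.exists_bound_of_continuous hf1.continuous
  have hF0 : ∀ q : ℝ × ℝ, R ≤ q.1 ∨ R ≤ q.2 → (f ∘ S) q = 0 := by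
    intro q hq
    have : ψ (S q) = 0 := by
      apply hψR
      have := hS3 q
      simp only [charCoord] at this
      rwa [← this] at hq
    simp [hf, this]
  obtain ⟨W, hW, -, -, hWk, hW0⟩ := exists_goursat hk (hf1.comp hS1) hkK (fun p => hC _) R R
  exact ⟨R, f ∘ S, W, by positivity, (hf1.comp hS1).continuous,
    fun p => by rw [Function.comp_apply, hS2], hF0, hW, hW0 hF0, hWk⟩

/-- The values of a weak solution on test functions, by duality. -/
theorem integral_weak_solution (h : IsRegularCoefficient c ε M) {u : ℝ → ℝ → ℝ}
    (hu : IsWeakWaveSolution c u) {k V : ℝ × ℝ → ℝ} (hV : IsRiemannFunction c k V)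
    {ψ : ℝ × ℝ → ℝ} (hψ : ContDiff ℝ 1 ψ) (hψc : HasCompactSupport ψ) :
    ∫ p in (univ : Set ℝ) ×ˢ Ioi (0 : ℝ), u p.1 p.2 * ψ p
      = ∫ p in (univ : Set ℝ) ×ˢ Ioi (0 : ℝ), coneSolution c V p * ψ p := by
  obtain ⟨K, hkK⟩ := hV.exists_bound
  obtain ⟨R, F, W, hR, hF, hFψ, hF0, hW, hW0, hWk⟩ :=
    h.exists_dual_solution hV.contDiff_potential hkK hψ hψc
  obtain ⟨σ, -, -, hσ2⟩ := h.exists_inverse_travelTime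
  have hb0 := h.amplitude_zero
  have hτ0 := travelTime_zero c
  have left : ∫ p in (univ : Set ℝ) ×ˢ Ioi (0 : ℝ), u p.1 p.2 * ψ p = W (0, 0) := by
    set φ₀ : ℝ × ℝ → ℝ := fun p => amplitude c p.1 * W (charCoord c p) with hφ₀
    have hφ₀2 : ContDiff ℝ 2 φ₀ := h.contDiff_liouville hW
    -- `φ₀` vanishes for large `s` or large `r` but may persist as `t → -∞`. The cutoff is `0` for
    -- `t ≤ -2` and `1` for `t ≥ -1`, so neither the equation on `t > 0` nor the value at the origin
    -- changes.
    set φ : ℝ × ℝ → ℝ := fun p => Real.smoothTransition (p.2 + 2) * φ₀ p with hφ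
    have hφ2 : ContDiff ℝ 2 φ := by
      have : ContDiff ℝ 2 Real.smoothTransition := Real.smoothTransition.contDiff (n := 2)
      fun_prop
    have hφc : HasCompactSupport φ := by
      refine HasCompactSupport.intro
        (isCompact_Icc (a := σ (-(R + 2))) (b := σ (R + 2)) |>.prod
          (isCompact_Icc (a := (-2 : ℝ)) (b := R))) fun p hp => ?_
      by_contra hne
      have h1 : -2 < p.2 := by
        by_contra hle
        exact hne (by simp [hφ, Real.smoothTransition.zero_of_nonpos
          (by linarith : p.2 + 2 ≤ 0)])
      have h2 : ¬ (R ≤ p.2 + travelTime c p.1 ∨ R ≤ p.2 - travelTime c p.1) := fun h2 =>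
        hne (by simp [hφ, hφ₀, hW0 (charCoord c p) h2])
      push Not at h2
      refine hp ⟨⟨?_, ?_⟩, ⟨h1.le, by linarith [h2.1, h2.2]⟩⟩
      · rw [← h.strictMono_travelTime.le_iff_le, hσ2]
        linarith [h2.2]
      · rw [← h.strictMono_travelTime.le_iff_le, hσ2]
        linarith [h2.1]
    have hφ00 : φ (0, 0) = W (0, 0) := by
      simp [hφ, hφ₀, charCoord, hτ0, hb0, Real.smoothTransition.one_of_one_le]
    have hev : ∀ p : ℝ × ℝ, -1 < p.2 → φ =ᶠ[𝓝 p] φ₀ := by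
      intro p hp
      filter_upwards [(isOpen_lt continuous_const continuous_snd).mem_nhds hp] with q hq
      have hq' : (1 : ℝ) ≤ q.2 + 2 := by linarith [show -1 < q.2 from hq]
      simp [hφ, Real.smoothTransition.one_of_one_le hq']
    have hc0 : c 0 = 1 := h.eq_one 0 fun hh => h.pos_left.not_ge hh.1
    have hweak := hu.weak_eq_of_contDiff_two h.contDiff.continuous hφ2 hφc
    rw [hc0, one_mul, hφ00] at hweak
    rw [← hweak]
    refine setIntegral_congr_fun (MeasurableSet.univ.prod measurableSet_Ioi) fun p hp => ?_
    have hp' : -1 < p.2 := by linarith [show 0 < p.2 from hp.2]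
    have e1 : pd₁ (pd₁ φ) p = pd₁ (pd₁ φ₀) p := by
      have h1 : pd₁ φ =ᶠ[𝓝 p] pd₁ φ₀ := (hev p hp').fderiv.fun_comp fun L => L (1, 0)
      rw [pd₁, h1.fderiv_eq, ← pd₁]
    have e2 : pd₂ (pd₂ φ) p = pd₂ (pd₂ φ₀) p := by
      have h1 : pd₂ φ =ᶠ[𝓝 p] pd₂ φ₀ := (hev p hp').fderiv.fun_comp fun L => L (0, 1)
      rw [pd₂, h1.fderiv_eq, ← pd₂]
    have e3 := h.wave_operator_liouville hW (φ := φ₀) (fun p => rfl) p.1 p.2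
    have e4 := hFψ p
    have e5 := hV.potential_eq p.1 p.2
    have hb := (h.amplitude_pos p.1).ne'
    simp only [e1, e2]
    rw [e3, hWk, e5]
    simp only [charCoord] at e4
    rw [e4]
    congr 1
    field_simp
    ring
  have right : ∫ p in (univ : Set ℝ) ×ˢ Ioi (0 : ℝ), coneSolution c V p * ψ p = W (0, 0) := by
    have hVc := hV.contDiff.continuous
    have s1 : ((univ : Set ℝ) ×ˢ Ioi (0 : ℝ) : Set (ℝ × ℝ)) =ᵐ[volume] univ ×ˢ Ici 0 :=
      Measure.set_prod_ae_eq (ae_eq_refl _) Ioi_ae_eq_Ici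
    have s2 : {p : ℝ × ℝ | |travelTime c p.1| ≤ p.2} ⊆ univ ×ˢ Ici 0 := fun p hp =>
      ⟨mem_univ _, show (0 : ℝ) ≤ p.2 from (abs_nonneg _).trans hp⟩
    rw [setIntegral_congr_set s1, setIntegral_eq_of_subset_of_forall_sdiff_eq_zero
      (MeasurableSet.univ.prod measurableSet_Ici) s2 fun p hp => by
        rw [coneSolution, indicator_of_notMem hp.2, zero_mul]]
    -- With the Jacobian `2 b⁻²` and `F = b³ψ/4`, the integrand `b V ψ` is `2 b⁻² · 2 V F`. Green's
    -- identity with boundary value `1/2` then yields `2 · (1/2) · W(0,0)`.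
    have s3 := h.integral_charCoord fun q => 2 * (V q * F q)
    have s4 : ∀ p ∈ {p : ℝ × ℝ | |travelTime c p.1| ≤ p.2}, coneSolution c V p * ψ p
        = 2 * (amplitude c p.1 ^ 2)⁻¹ * (2 * (V (charCoord c p) * F (charCoord c p))) := by
      intro p hp
      have hb := (h.amplitude_pos p.1).ne'
      rw [coneSolution, indicator_of_mem hp, hFψ]
      field_simp
      ring
    rw [setIntegral_congr_fun h.measurableSet_cone s4, ← s3]
    have s5 : Icc (0 : ℝ) R ×ˢ Icc (0 : ℝ) R ⊆ Ici (0 : ℝ) ×ˢ Ici (0 : ℝ) :=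
      Set.prod_mono Icc_subset_Ici_self Icc_subset_Ici_self
    rw [setIntegral_eq_of_subset_of_forall_sdiff_eq_zero
      (measurableSet_Ici.prod measurableSet_Ici) s5 fun q hq => by
        have : R ≤ q.1 ∨ R ≤ q.2 := by
          by_contra hlt
          push Not at hlt
          exact hq.2 ⟨⟨hq.1.1, hlt.1.le⟩, ⟨hq.1.2, hlt.2.le⟩⟩
        rw [hF0 q this]
        ring]
    rw [Measure.volume_eq_prod, setIntegral_prod _ (ContinuousOn.integrableOn_compact
      (isCompact_Icc.prod isCompact_Icc) (by fun_prop))]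
    have green := green_rectangle hV.contDiff hW hV.left_eq hV.right_eq hV.pd_eq
      (fun r => hW0 (R, r) (Or.inl le_rfl)) (fun s => hW0 (s, R) (Or.inr le_rfl)) hWk
    simp only [integral_const_mul, integral_Icc_eq_integral_Ioc,
      ← intervalIntegral.integral_of_le hR.le, green]
    ring
  rw [left, right]

theorem _root_.integrableOn_mul_of_hasCompactSupport {f ψ : ℝ × ℝ → ℝ}
    (hf : LocallyIntegrableOn f ((univ : Set ℝ) ×ˢ Ici (0 : ℝ)) volume) (hψ : Continuous ψ)
    (hψc : HasCompactSupport ψ) :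
    IntegrableOn (fun p => f p * ψ p) ((univ : Set ℝ) ×ˢ Ioi (0 : ℝ)) volume := by
  have hc : IsClosed ((univ : Set ℝ) ×ˢ Ici (0 : ℝ)) := isClosed_univ.prod isClosed_Ici
  have h1 : IntegrableOn f (tsupport ψ ∩ (univ ×ˢ Ici 0)) volume :=
    hf.integrableOn_compact_subset inter_subset_right (hψc.isCompact.inter_right hc)
  obtain ⟨C, hC⟩ := hψc.exists_bound_of_continuous hψ
  have h2 : IntegrableOn (fun p => f p * ψ p) (tsupport ψ ∩ (univ ×ˢ Ici 0)) volume :=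
    Integrable.mul_bdd (c := C) h1 hψ.aestronglyMeasurable (Eventually.of_forall hC)
  have h3 : IntegrableOn (fun p => f p * ψ p) (univ ×ˢ Ici 0) volume :=
    h2.of_forall_sdiff_eq_zero hc.measurableSet fun p hp => by
      have : ψ p = 0 := image_eq_zero_of_notMem_tsupport fun hh => hp.2 ⟨hh, hp.1⟩
      rw [this, mul_zero]
  exact h3.mono_set (Set.prod_mono le_rfl Ioi_subset_Ici_self)

/-- Every weak solution is given by the Riemann function, almost everywhere. -/
theorem ae_eq_coneSolution (h : IsRegularCoefficient c ε M) {u : ℝ → ℝ → ℝ}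
    (hu : IsWeakWaveSolution c u) {k V : ℝ × ℝ → ℝ} (hV : IsRiemannFunction c k V) :
    coneSolution c V =ᵐ[volume.restrict ((univ : Set ℝ) ×ˢ Ioi (0 : ℝ))] fun p => u p.1 p.2 := by
  have hU : IsOpen ((univ : Set ℝ) ×ˢ Ioi (0 : ℝ)) := isOpen_univ.prod isOpen_Ioi
  have hVi : LocallyIntegrableOn (coneSolution c V) ((univ : Set ℝ) ×ˢ Ici (0 : ℝ)) volume :=
    (h.locallyIntegrable_coneSolution hV.contDiff).locallyIntegrableOn _
  have key := hU.ae_eq_zero_of_integral_contDiff_smul_eq_zero (μ := volume)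
    (f := fun p => coneSolution c V p - u p.1 p.2)
    ((hVi.sub hu.locallyIntegrable).mono_set (Set.prod_mono le_rfl Ioi_subset_Ici_self))
    fun ψ hψ hψc hψU => by
      have hz : ∀ p, p ∉ (univ : Set ℝ) ×ˢ Ioi (0 : ℝ) →
          ψ p • (coneSolution c V p - u p.1 p.2) = 0 := fun p hp => by
        rw [image_eq_zero_of_notMem_tsupport fun hh => hp (hψU hh), zero_smul]
      rw [← setIntegral_eq_integral_of_forall_compl_eq_zero hz]
      have e : ∀ p : ℝ × ℝ, ψ p • (coneSolution c V p - u p.1 p.2)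
          = coneSolution c V p * ψ p - u p.1 p.2 * ψ p := fun p => by
        rw [smul_eq_mul]
        ring
      simp only [e]
      rw [integral_sub (integrableOn_mul_of_hasCompactSupport hVi hψ.continuous hψc)
        (integrableOn_mul_of_hasCompactSupport hu.locallyIntegrable hψ.continuous hψc),
        h.integral_weak_solution hu hV (hψ.of_le (by exact_mod_cast le_top)) hψc, sub_self]
  rw [Filter.EventuallyEq, ae_restrict_iff' hU.measurableSet]
  filter_upwards [key] with p hp hpU
  exact sub_eq_zero.1 (hp hpU)

end IsRegularCoefficient

/-! ### The pointwise version and the retarded solution. -/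

namespace IsRegularCoefficient

variable {c : ℝ → ℝ} {ε M : ℝ}

theorem isPointwiseVersion_coneSolution (h : IsRegularCoefficient c ε M) {u : ℝ → ℝ → ℝ}
    (hu : IsWeakWaveSolution c u) {k V : ℝ × ℝ → ℝ} (hV : IsRiemannFunction c k V) :
    IsPointwiseVersion c u fun x t => coneSolution c V (x, t) where
  ae_eq := h.ae_eq_coneSolution hu hV
  continuousOn := (h.contDiff_liouville hV.contDiff).continuous.continuousOn.congr
    fun _ hp => indicator_of_mem hp _
  eq_zero x t hxt := indicator_of_notMem
    (show (x, t) ∉ {p : ℝ × ℝ | |travelTime c p.1| ≤ p.2} from hxt.not_ge) _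

/-- The pointwise version of a solution is unique. -/
theorem pointwiseVersion_unique (h : IsRegularCoefficient c ε M) {u U₁ U₂ : ℝ → ℝ → ℝ}
    (h₁ : IsPointwiseVersion c u U₁) (h₂ : IsPointwiseVersion c u U₂) (x t : ℝ) :
    U₁ x t = U₂ x t := by
  have hτ := h.continuous_travelTime
  rcases lt_or_ge t |travelTime c x| with hlt | hle
  · rw [h₁.eq_zero _ _ hlt, h₂.eq_zero _ _ hlt]
  set O : Set (ℝ × ℝ) := {p | |travelTime c p.1| < p.2} with hO
  have hOo : IsOpen O := isOpen_lt (by fun_prop) continuous_snd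
  have hOS : O ⊆ (univ : Set ℝ) ×ˢ Ioi (0 : ℝ) := fun p hp =>
    ⟨mem_univ _, show (0 : ℝ) < p.2 from (abs_nonneg _).trans_lt hp⟩
  have hOC : O ⊆ {p | |travelTime c p.1| ≤ p.2} := fun p hp =>
    le_of_lt (show |travelTime c p.1| < p.2 from hp)
  have hae := ae_restrict_of_ae_restrict_of_subset hOS (h₁.ae_eq.trans h₂.ae_eq.symm)
  have heq := Measure.eqOn_open_of_ae_eq hae hOo (h₁.continuousOn.mono hOC)
    (h₂.continuousOn.mono hOC)
  refine heq.of_subset_closure h₁.continuousOn h₂.continuousOn hOC (fun p hp => ?_)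
    (show (x, t) ∈ {p : ℝ × ℝ | |travelTime c p.1| ≤ p.2} from hle)
  -- Points of the front are limits of points of the open cone, approached vertically from later
  -- times.
  have hlim : Tendsto (fun s : ℝ => ((p.1, p.2 + s) : ℝ × ℝ)) (𝓝[>] 0) (𝓝 p) := by
    have : Continuous fun s : ℝ => ((p.1, p.2 + s) : ℝ × ℝ) := by fun_prop
    simpa using (this.tendsto 0).mono_left nhdsWithin_le_nhds
  refine mem_closure_of_tendsto hlim ?_
  filter_upwards [self_mem_nhdsWithin] with s hs
  have h1 : |travelTime c p.1| ≤ p.2 := hp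
  have h2 : 0 < s := hs
  exact show |travelTime c p.1| < p.2 + s by linarith

/-- The solution along the forward characteristics to the right of the source. -/
noncomputable def _root_.retardedSolution (c : ℝ → ℝ) (V : ℝ × ℝ → ℝ) (p : ℝ × ℝ) : ℝ :=
  amplitude c p.1 * V (p.2 + 2 * travelTime c p.1, p.2)

theorem contDiff_retardedSolution (h : IsRegularCoefficient c ε M) {V : ℝ × ℝ → ℝ}
    (hV : ContDiff ℝ 2 V) : ContDiff ℝ 2 (retardedSolution c V) := by
  have h1 : ContDiff ℝ 2 (amplitude c) := h.contDiff_amplitude.of_le (by norm_num)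
  have h2 : ContDiff ℝ 2 (travelTime c) := h.contDiff_travelTime.of_le (by norm_num)
  unfold retardedSolution
  fun_prop

theorem coneSolution_eq_retardedSolution {V : ℝ × ℝ → ℝ} {x t : ℝ} (hxt : |travelTime c x| ≤ t) :
    coneSolution c V (x, t) = retardedSolution c V (x, t - travelTime c x) := by
  rw [coneSolution, indicator_of_mem (show (x, t) ∈ {p : ℝ × ℝ | |travelTime c p.1| ≤ p.2} from hxt),
    retardedSolution, charCoord]
  ring_nf

theorem hasDerivAt_retarded_left (h : IsRegularCoefficient c ε M) {g : ℝ × ℝ → ℝ}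
    (hg : ContDiff ℝ 1 g) (x t : ℝ) :
    HasDerivAt (fun x => g (t + 2 * travelTime c x, t))
      (2 * pd₁ g (t + 2 * travelTime c x, t) / amplitude c x ^ 2) x := by
  refine (hasDerivAt_comp_curve hg (((h.hasDerivAt_travelTime x).const_mul 2).const_add t)
    (hasDerivAt_const x t)).congr_deriv ?_
  ring

theorem hasDerivAt_retarded_right {g : ℝ × ℝ → ℝ} (hg : ContDiff ℝ 1 g) (c : ℝ → ℝ) (x t : ℝ) :
    HasDerivAt (fun t => g (t + 2 * travelTime c x, t))
      (pd₁ g (t + 2 * travelTime c x, t) + pd₂ g (t + 2 * travelTime c x, t)) t := by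
  refine (hasDerivAt_comp_curve hg ((hasDerivAt_id t).add_const (2 * travelTime c x))
    (hasDerivAt_id t)).congr_deriv ?_
  simp

theorem pd₁_retardedSolution (h : IsRegularCoefficient c ε M) {V : ℝ × ℝ → ℝ}
    (hV : ContDiff ℝ 2 V) (x t : ℝ) : pd₁ (retardedSolution c V) (x, t)
      = deriv (amplitude c) x * V (t + 2 * travelTime c x, t)
        + 2 * ((amplitude c x)⁻¹ * pd₁ V (t + 2 * travelTime c x, t)) := by
  refine (hasDerivAt_pd₁ ((h.contDiff_retardedSolution hV).of_le (by norm_num)) x t).unique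
    (((h.hasDerivAt_amplitude x).mul
      (h.hasDerivAt_retarded_left (hV.of_le (by norm_num)) x t)).congr_deriv ?_)
  have := (h.amplitude_pos x).ne'
  field_simp

theorem pd₂_retardedSolution (h : IsRegularCoefficient c ε M) {V : ℝ × ℝ → ℝ}
    (hV : ContDiff ℝ 2 V) (x t : ℝ) : pd₂ (retardedSolution c V) (x, t)
      = amplitude c x * (pd₁ V (t + 2 * travelTime c x, t)
        + pd₂ V (t + 2 * travelTime c x, t)) :=
  (hasDerivAt_pd₂ ((h.contDiff_retardedSolution hV).of_le (by norm_num)) x t).unique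
    ((hasDerivAt_retarded_right (hV.of_le (by norm_num)) c x t).const_mul (amplitude c x))

/-- The differential equation for the retarded solution. -/
theorem retardedSolution_pde (h : IsRegularCoefficient c ε M) {k V : ℝ × ℝ → ℝ}
    (hV : IsRiemannFunction c k V) (x t : ℝ) :
    pd₁ (pd₁ (retardedSolution c V)) (x, t)
      - pd₂ (pd₁ (retardedSolution c V)) (x, t) / (2 * (amplitude c x / 2) ^ 2)
      + pd₂ (retardedSolution c V) (x, t) * (deriv (amplitude c) x / 2)
        / (2 * (amplitude c x / 2) ^ 3) = 0 := by
  have hV2 := hV.contDiff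
  have hV1 : ContDiff ℝ 1 V := hV2.of_le (by norm_num)
  have hVx := contDiff_one_pd₁ hV2
  have hQ := contDiff_one_pd₁ (h.contDiff_retardedSolution hV2)
  have hb := (h.amplitude_pos x).ne'
  have e11 := (hasDerivAt_pd₁ hQ x t).unique ((((h.hasDerivAt_deriv_amplitude x).mul
    (h.hasDerivAt_retarded_left hV1 x t)).add
    ((((h.hasDerivAt_amplitude x).inv hb).mul
      (h.hasDerivAt_retarded_left hVx x t)).const_mul 2)).congr_of_eventuallyEq
        (Eventually.of_forall fun y => h.pd₁_retardedSolution hV2 y t))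
  have e12 := (hasDerivAt_pd₂ hQ x t).unique ((((hasDerivAt_retarded_right hV1 c x t).const_mul
    (deriv (amplitude c) x)).add
    (((hasDerivAt_retarded_right hVx c x t).const_mul (amplitude c x)⁻¹).const_mul 2)
      ).congr_of_eventuallyEq (Eventually.of_forall fun s => h.pd₁_retardedSolution hV2 x s))
  -- The retarded point `(t + 2τ, t)` corresponds to time `t + τ(x)`. In the equation the `V_ss`
  -- terms and the terms `b' (V_s + V_r)` cancel, leaving `b'' V - 4 b⁻³ V_sr`.
  have hk := hV.potential_eq x (t + travelTime c x)
  rw [show t + travelTime c x + travelTime c x = t + 2 * travelTime c x by ring,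
    add_sub_cancel_right] at hk
  rw [e11, e12, h.pd₂_retardedSolution hV2, hV.pd_eq, hk]
  simp only [Pi.inv_apply]
  field_simp
  ring

theorem _root_.IsRiemannFunction.pd₁_right {k V : ℝ × ℝ → ℝ} (hV : IsRiemannFunction c k V)
    (s : ℝ) :
    pd₁ V (s, 0) = 0 := by
  refine (hasDerivAt_pd₁ (hV.contDiff.of_le (by norm_num)) s 0).unique ?_
  simpa only [hV.right_eq] using hasDerivAt_const s (1 / 2 : ℝ)

theorem retardedSolution_zero {k V : ℝ × ℝ → ℝ} (hV : IsRiemannFunction c k V) (x : ℝ) :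
    retardedSolution c V (x, 0) = amplitude c x / 2 := by
  rw [retardedSolution, hV.right_eq]
  ring

/-- Continuity from `x < ε`. It gives `τ'(ε) = 1`, so that the boundary condition reads `q_x = u_x +
u_t` without a factor. -/
theorem amplitude_left (h : IsRegularCoefficient c ε M) : amplitude c ε = 1 := by
  have : EqOn (amplitude c) (fun _ => 1) (closure (Iio ε)) :=
    EqOn.closure (fun y hy => h.amplitude_eq_one fun hh => hy.not_ge hh.1)
      h.contDiff_amplitude.continuous continuous_const
  rw [closure_Iio] at this
  exact this (mem_Iic.2 le_rfl)

end IsRegularCoefficient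

/-! ### The main theorem. -/

theorem mainTheorem6
    (ε M T clo chi : ℝ) (hε : 0 < ε) (hεM : ε < M) (hT : 0 < T)
    (hlo : 0 < clo) (hlohi : clo < chi)
    (c : ℝ → ℝ) (hc : ContDiff ℝ 3 c)
    (hc_in : ∀ x ∈ Icc ε M, c x ∈ Icc clo chi)
    (hc_out : ∀ x, x ∉ Icc ε M → c x = 1)
    (u : ℝ → ℝ → ℝ) (hu : IsWeakWaveSolution c u) :
    -- the solution has a pointwise version ...
    (∃ U : ℝ → ℝ → ℝ, IsPointwiseVersion c u U) ∧
    -- ... and for this version, with `q(x,t) = u(x, t + τ(x))` and the data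
    -- `g₀(t) = u(ε,t)`, `g₁(t) = u_x(ε,t)`:
    ∀ U : ℝ → ℝ → ℝ, IsPointwiseVersion c u U →
    ∀ q : ℝ → ℝ → ℝ, (∀ x t, q x t = U x (t + travelTime c x)) →
    ∀ g₀ g₁ : ℝ → ℝ, (∀ t, g₀ t = U ε t) → (∀ t, g₁ t = deriv (fun x => U x t) ε) →
      -- the derivatives of `q` below exist in the classical sense
      ContDiffOn ℝ 2 (fun p : ℝ × ℝ => q p.1 p.2) (Ioi 0 ×ˢ Ici 0) ∧
      -- the differential equation in `(ε, M) × (0, T)`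
      (∀ x ∈ Ioo ε M, ∀ t ∈ Ioo 0 T,
        deriv (fun y => deriv (fun z => q z t) y) x
          - deriv (fun s => deriv (fun y => q y s) x) t / (2 * q x 0 ^ 2)
          + deriv (fun s => q x s) t * deriv (fun y => q y 0) x / (2 * q x 0 ^ 3) = 0) ∧
      -- the lower bound
      (0 < 1 / (2 * chi ^ (1 / 4 : ℝ)) ∧
        ∀ x ∈ Icc ε M, 1 / (2 * chi ^ (1 / 4 : ℝ)) ≤ q x 0) ∧
      -- the boundary condition for `q` at `x = ε`
      (∀ t ∈ Icc 0 T, q ε t = g₀ (t + ε)) ∧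
      -- the boundary condition for `q_x` at `x = ε`, for `0 < t ≤ T` ...
      (∀ t ∈ Ioc 0 T,
        DifferentiableAt ℝ (fun x => U x (t + ε)) ε ∧ DifferentiableAt ℝ g₀ (t + ε) ∧
        deriv (fun y => q y t) ε = g₁ (t + ε) + deriv g₀ (t + ε)) ∧
      -- ... and for `t = 0`, where `g₁(ε)` and `g₀'(ε)` are limits from the right
      (∃ a b : ℝ, Tendsto g₁ (𝓝[>] ε) (𝓝 a) ∧ Tendsto (deriv g₀) (𝓝[>] ε) (𝓝 b) ∧
        deriv (fun y => q y 0) ε = a + b) ∧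
      -- the boundary condition at `x = M`
      (∀ t ∈ Icc 0 T, deriv (fun y => q y t) M = 0) ∧
      -- recovery of the coefficient
      (∀ x ∈ Icc ε M, c x = 1 / (16 * q x 0 ^ 4)) := by
  have h : IsRegularCoefficient c ε M := by
    refine ⟨hc, hε, hεM, ⟨min clo 1, by positivity, fun x => ?_⟩, hc_out⟩
    by_cases hx : x ∈ Icc ε M
    · exact (min_le_left _ _).trans (hc_in x hx).1
    · exact (min_le_right _ _).trans (hc_out x hx).ge
  obtain ⟨k, V, hV, hVM⟩ := h.exists_isRiemannFunction
  have hver := h.isPointwiseVersion_coneSolution hu hV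
  refine ⟨⟨_, hver⟩, fun U hU q hq g₀ g₁ hg₀ hg₁ => ?_⟩
  have hUV : ∀ x t, |travelTime c x| ≤ t →
      U x t = retardedSolution c V (x, t - travelTime c x) := fun x t hxt => by
    rw [h.pointwiseVersion_unique hU hver x t, IsRegularCoefficient.coneSolution_eq_retardedSolution hxt]
  set Q := retardedSolution c V with hQdef
  have hQ2 : ContDiff ℝ 2 Q := h.contDiff_retardedSolution hV.contDiff
  have hQ1 : ContDiff ℝ 1 Q := hQ2.of_le (by norm_num)
  have hQx := contDiff_one_pd₁ hQ2
  have hqQ : ∀ x t, 0 ≤ x → 0 ≤ t → q x t = Q (x, t) := fun x t hx ht => by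
    have h0 := h.travelTime_nonneg hx
    rw [hq, hUV _ _ (by rw [abs_of_nonneg h0]; linarith), add_sub_cancel_right]
  have hq0 : ∀ x, 0 ≤ x → q x 0 = amplitude c x / 2 := fun x hx => by
    rw [hqQ x 0 hx le_rfl, hQdef, IsRegularCoefficient.retardedSolution_zero hV]
  have hqx : ∀ x t, 0 < x → 0 ≤ t → deriv (fun y => q y t) x = pd₁ Q (x, t) := fun x t hx ht => by
    have : (fun y => q y t) =ᶠ[𝓝 x] fun y => Q (y, t) := by
      filter_upwards [lt_mem_nhds hx] with y hy
      exact hqQ y t hy.le ht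
    rw [this.deriv_eq, (hasDerivAt_pd₁ hQ1 x t).deriv]
  have hqt : ∀ x t, 0 ≤ x → 0 < t → deriv (fun s => q x s) t = pd₂ Q (x, t) := fun x t hx ht => by
    have : (fun s => q x s) =ᶠ[𝓝 t] fun s => Q (x, s) := by
      filter_upwards [lt_mem_nhds ht] with s hs
      exact hqQ x s hx hs.le
    rw [this.deriv_eq, (hasDerivAt_pd₂ hQ1 x t).deriv]
  have hτε := h.travelTime_eq_self
  -- For `t > 0` the point `(ε, t + ε)` lies strictly behind the front, so `U` agrees with a `C²`
  -- expression nearby. At `t = 0` the jump across the front leaves only one-sided limits.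
  have hUx : ∀ t, 0 < t →
      HasDerivAt (fun x => U x (t + ε)) (pd₁ Q (ε, t) - pd₂ Q (ε, t)) ε := fun t ht => by
    have hev : (fun x => U x (t + ε)) =ᶠ[𝓝 ε] fun x => Q (x, t + ε - travelTime c x) := by
      have hlt : |travelTime c ε| < t + ε := by
        rw [hτε, abs_of_pos hε]
        linarith
      filter_upwards [(h.continuous_travelTime.abs.continuousAt (x := ε)).eventually_lt
        continuousAt_const hlt] with x hx
      exact hUV _ _ hx.le
    have hd := hasDerivAt_comp_curve hQ1 (hasDerivAt_id ε)
      ((h.hasDerivAt_travelTime ε).const_sub (t + ε))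
    refine (hd.congr_of_eventuallyEq hev).congr_deriv ?_
    simp only [id, hτε, add_sub_cancel_right, h.amplitude_left]
    ring
  have hg₀d : ∀ t, 0 < t → HasDerivAt g₀ (pd₂ Q (ε, t)) (t + ε) := fun t ht => by
    have hev : g₀ =ᶠ[𝓝 (t + ε)] fun s => Q (ε, s - ε) := by
      filter_upwards [lt_mem_nhds (show ε < t + ε by linarith)] with s hs
      rw [hg₀, hUV _ _ (by rw [hτε, abs_of_pos hε]; exact hs.le), hτε]
    have hd := hasDerivAt_pd₂ hQ1 ε t
    rw [← add_sub_cancel_right t ε] at hd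
    refine (hd.comp_sub_const (t + ε) ε).congr_of_eventuallyEq hev |>.congr_deriv ?_
    rw [add_sub_cancel_right]
  have hM : 0 < M := hε.trans hεM
  refine ⟨?_, ?_, ⟨?_, ?_⟩, ?_, ?_, ?_, ?_, ?_⟩
  · exact hQ2.contDiffOn.congr fun p hp => hqQ p.1 p.2 (le_of_lt hp.1) hp.2
  · intro x hx t ht
    have hx0 : 0 < x := hε.trans hx.1
    have e1 : deriv (fun y => deriv (fun z => q z t) y) x = pd₁ (pd₁ Q) (x, t) := by
      have : (fun y => deriv (fun z => q z t) y) =ᶠ[𝓝 x] fun y => pd₁ Q (y, t) := by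
        filter_upwards [lt_mem_nhds hx0] with y hy
        exact hqx y t hy ht.1.le
      rw [this.deriv_eq, (hasDerivAt_pd₁ hQx x t).deriv]
    have e2 : deriv (fun s => deriv (fun y => q y s) x) t = pd₂ (pd₁ Q) (x, t) := by
      have : (fun s => deriv (fun y => q y s) x) =ᶠ[𝓝 t] fun s => pd₁ Q (x, s) := by
        filter_upwards [lt_mem_nhds ht.1] with s hs
        exact hqx x s hx0 hs.le
      rw [this.deriv_eq, (hasDerivAt_pd₂ hQx x t).deriv]
    have e3 : pd₁ Q (x, 0) = deriv (amplitude c) x / 2 := by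
      rw [hQdef, h.pd₁_retardedSolution hV.contDiff, hV.pd₁_right, hV.right_eq]
      ring
    rw [e1, e2, hqt x t hx0.le ht.1, hqx x 0 hx0 le_rfl, e3, hq0 x hx0.le]
    exact h.retardedSolution_pde hV x t
  · have : 0 < chi := hlo.trans hlohi
    positivity
  · intro x hx
    have h1 : c x ^ (1 / 4 : ℝ) ≤ chi ^ (1 / 4 : ℝ) :=
      Real.rpow_le_rpow (h.pos x).le (hc_in x hx).2 (by norm_num)
    have h2 : 0 < c x ^ (1 / 4 : ℝ) := Real.rpow_pos_of_pos (h.pos x) _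
    rw [hq0 x (hε.le.trans hx.1), amplitude, Real.rpow_neg (h.pos x).le, ← one_div, div_div,
      mul_comm _ (2 : ℝ)]
    gcongr
  · intro t _
    rw [hq, hg₀, hτε]
  · intro t ht
    refine ⟨(hUx t ht.1).differentiableAt, (hg₀d t ht.1).differentiableAt, ?_⟩
    rw [hqx ε t hε ht.1.le, hg₁, (hUx t ht.1).deriv, (hg₀d t ht.1).deriv, sub_add_cancel]
  · have hcx := hQx.continuous
    have hct := (contDiff_one_pd₂ hQ2).continuous
    -- The limits are the derivative formulas valid for `t > 0`, evaluated at `t = 0` through the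
    -- extension `Q`, whose partial derivatives are continuous there.
    refine ⟨pd₁ Q (ε, 0) - pd₂ Q (ε, 0), pd₂ Q (ε, 0), ?_, ?_, ?_⟩
    · have hlim : Tendsto (fun s => pd₁ Q (ε, s - ε) - pd₂ Q (ε, s - ε)) (𝓝[>] ε)
          (𝓝 (pd₁ Q (ε, 0) - pd₂ Q (ε, 0))) := by
        have : Continuous fun s => pd₁ Q (ε, s - ε) - pd₂ Q (ε, s - ε) := by fun_prop
        simpa using (this.tendsto ε).mono_left nhdsWithin_le_nhds
      refine hlim.congr' ?_
      filter_upwards [self_mem_nhdsWithin] with s hs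
      have := (hUx (s - ε) (sub_pos.2 hs)).deriv
      rw [sub_add_cancel] at this
      rw [hg₁, this]
    · have hlim : Tendsto (fun s => pd₂ Q (ε, s - ε)) (𝓝[>] ε) (𝓝 (pd₂ Q (ε, 0))) := by
        have : Continuous fun s => pd₂ Q (ε, s - ε) := by fun_prop
        simpa using (this.tendsto ε).mono_left nhdsWithin_le_nhds
      refine hlim.congr' ?_
      filter_upwards [self_mem_nhdsWithin] with s hs
      have := (hg₀d (s - ε) (sub_pos.2 hs)).deriv
      rw [sub_add_cancel] at this
      rw [this]
    · rw [hqx ε 0 hε le_rfl, sub_add_cancel]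
  · intro t ht
    -- Both terms of `q_x` vanish: `b'(M) = 0`, and `V_s = 0` because `s - r = 2τ(M)` exactly on
    -- this line.
    rw [hqx M t hM ht.1, hQdef, h.pd₁_retardedSolution hV.contDiff,
      h.deriv_amplitude_eq_zero_of_le le_rfl, hVM _ _ ht.1 (by linarith)]
    ring
  · intro x hx
    rw [hq0 x (hε.le.trans hx.1), h.eq_amplitude x]
    have := (h.amplitude_pos x).ne'
    field_simp
    norm_num
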